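/- Let $D=\{xy=0\}\subset\mathbb{C}^2$ and let $T_{\mathbb{C}^2}(-\log D)$ be the holomorphic Lie algebroid whose sections over an open set $U$ are the holomorphic vector fields on $U$ tangent to $D$; it is freely generated by $x\partial_x$ and $y\partial_y$. The logarithmic form $\omega=\frac{dx\wedge dy}{xy}$ is a closed holomorphic $2$-form on this Lie algebroid. It defines a central extension of holomorphic Lie algebroids $$0\to\mathbb{C}_{\mathbb{C}^2}\to T_{\mathbb{C}^2}(-\log D)\oplus\mathbb{C}_{\mathbb{C}^2}\to T_{\mathbb{C}^2}(-\log D)\to 0,$$ with bracket $[(X,f),(Y,g)]=([X,Y],\,X g-Y f+\omega(X,Y))$ and anchor $(X,f)\mapsto X$. Let $H$ be the complex Heisenberg group of matrices $$(a,b,c)=\begin{pmatrix}1&a&c\\0&1&b\\0&0&1\end{pmatrix},\qquad a,b,c\in\mathbb{C},$$ acting on $\mathbb{C}^2$ by $(a,b,c)\cdot(x,y)=(e^a x,e^b y)$, and let the additive group $\mathbb{C}^2$ act on $\mathbb{C}^2$ by $(a,b)\cdot(x,y)=(e^a x,e^b y)$. Then the action groupoids form a central extension of holomorphic Lie groupoids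 over $\mathbb{C}^2$ (in particular a principal $\mathbb{C}_{\mathbb{C}^2}$-bundle over $\mathbb{C}^2\ltimes\mathbb{C}^2$) $$0\to\mathbb{C}_{\mathbb{C}^2}\to H\ltimes\mathbb{C}^2\to\mathbb{C}^2\ltimes\mathbb{C}^2\to 0,$$ with projection $((a,b,c),(x,y))\mapsto((a,b),(x,y))$ and inclusion $((x,y),c)\mapsto((0,0,-c),(x,y))$, and this extension integrates the one defined by $\omega$: its Lie algebroid sequence is isomorphic to the sequence above, as an extension by $\mathbb{C}_{\mathbb{C}^2}$. Here the Lie algebroid of a Lie groupoid is the kernel of the differential of the source map along the units, with the bracket of right-invariant vector fields and the differential of the target map as anchor. With these conventions, the same groupoid sequence with the inclusion $((x,y),c)\mapsto((0,0,c),(x,y))$ is also a central extension, and it integrates the Lie algebroid extension defined in the same way by $-\omega$. -/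

import Mathlib

open scoped Manifold ContDiff Topology

noncomputable section

/-! ### Holomorphic Lie algebroids

A holomorphic vector bundle over a complex manifold `M` is encoded by its fibres together with the
predicate "`σ` is a holomorphic section over `U`".  Sections are total functions of which only the
values on `U` matter. -/

/-- The data of a Lie algebroid over `M`: fibres, holomorphic sections over subsets of `M`,
anchor to the tangent bundle, bracket of sections. -/
structure LieAlgebroidData {E : Type} [NormedAddCommGroup E] [NormedSpace ℂ E]
    {H : Type} [TopologicalSpace H] (I : ModelWithCorners ℂ E H)
    (M : Type) [TopologicalSpace M] [ChartedSpace H M] where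
  Fib : M → Type
  [addCommGroupFib : ∀ x, AddCommGroup (Fib x)]
  [moduleFib : ∀ x, Module ℂ (Fib x)]
  IsHol : Set M → (∀ x, Fib x) → Prop
  anchor : ∀ x, Fib x →ₗ[ℂ] TangentSpace I x
  bracket : (∀ x, Fib x) → (∀ x, Fib x) → (∀ x, Fib x)

attribute [instance] LieAlgebroidData.addCommGroupFib LieAlgebroidData.moduleFib

namespace LieAlgebroidData

variable {E : Type} [NormedAddCommGroup E] [NormedSpace ℂ E]
  {H : Type} [TopologicalSpace H] {I : ModelWithCorners ℂ E H}
  {M : Type} [TopologicalSpace M] [ChartedSpace H M]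

/-- The derivative `a(σ) f` of a function `f` along the anchor of a section `σ`. -/
def deriv (A : LieAlgebroidData I M) (σ : ∀ x, A.Fib x) (f : M → ℂ) : M → ℂ :=
  fun x => mfderiv I 𝓘(ℂ, ℂ) f x (A.anchor x (σ x))

/-- The axioms of a holomorphic Lie algebroid: the sheaf `IsHol` is the sheaf of sections of a
holomorphic vector bundle of finite rank (it has local frames), the anchor is holomorphic, and the
bracket is a local Lie bracket on holomorphic sections that satisfies the Leibniz rule. -/
structure IsLieAlgebroid [IsManifold I ω M] (A : LieAlgebroidData I M) : Prop where
  isHol_congr : ∀ (U : Set M) (σ τ : ∀ x, A.Fib x), (∀ x ∈ U, σ x = τ x) →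
    A.IsHol U σ → A.IsHol U τ
  isHol_mono : ∀ (U V : Set M) (σ : ∀ x, A.Fib x), IsOpen U → IsOpen V → V ⊆ U →
    A.IsHol U σ → A.IsHol V σ
  isHol_of_local : ∀ (U : Set M) (σ : ∀ x, A.Fib x), IsOpen U →
    (∀ x ∈ U, ∃ V, IsOpen V ∧ x ∈ V ∧ V ⊆ U ∧ A.IsHol V σ) → A.IsHol U σ
  exists_frame : ∀ x₀ : M, ∃ (U : Set M) (r : ℕ) (e : Fin r → ∀ x, A.Fib x),
    IsOpen U ∧ x₀ ∈ U ∧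
    (∀ x ∈ U, LinearIndependent ℂ (fun i => e i x) ∧
      Submodule.span ℂ (Set.range fun i => e i x) = ⊤) ∧
    ∀ (V : Set M) (σ : ∀ x, A.Fib x), IsOpen V → V ⊆ U →
      (A.IsHol V σ ↔ ∃ c : Fin r → M → ℂ, (∀ i, ContMDiffOn I 𝓘(ℂ, ℂ) ω (c i) V) ∧
        ∀ x ∈ V, σ x = ∑ i, c i x • e i x)
  anchor_hol : ∀ (U : Set M) (σ : ∀ x, A.Fib x), IsOpen U → A.IsHol U σ →
    ContMDiffOn I I.tangent ω (fun x => (⟨x, A.anchor x (σ x)⟩ : TangentBundle I M)) U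
  bracket_hol : ∀ (U : Set M) (σ τ : ∀ x, A.Fib x), IsOpen U → A.IsHol U σ → A.IsHol U τ →
    A.IsHol U (A.bracket σ τ)
  bracket_congr : ∀ (U : Set M) (σ σ' τ τ' : ∀ x, A.Fib x), IsOpen U →
    A.IsHol U σ → A.IsHol U τ → (∀ x ∈ U, σ x = σ' x) → (∀ x ∈ U, τ x = τ' x) →
    ∀ x ∈ U, A.bracket σ τ x = A.bracket σ' τ' x
  bracket_antisymm : ∀ (U : Set M) (σ τ : ∀ x, A.Fib x), IsOpen U → A.IsHol U σ → A.IsHol U τ →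
    ∀ x ∈ U, A.bracket σ τ x = -A.bracket τ σ x
  bracket_add : ∀ (U : Set M) (σ τ υ : ∀ x, A.Fib x), IsOpen U →
    A.IsHol U σ → A.IsHol U τ → A.IsHol U υ →
    ∀ x ∈ U, A.bracket σ (fun y => τ y + υ y) x = A.bracket σ τ x + A.bracket σ υ x
  leibniz : ∀ (U : Set M) (f : M → ℂ) (σ τ : ∀ x, A.Fib x), IsOpen U →
    ContMDiffOn I 𝓘(ℂ, ℂ) ω f U → A.IsHol U σ → A.IsHol U τ →
    ∀ x ∈ U, A.bracket σ (fun y => f y • τ y) x = f x • A.bracket σ τ x + A.deriv σ f x • τ x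
  jacobi : ∀ (U : Set M) (σ τ υ : ∀ x, A.Fib x), IsOpen U →
    A.IsHol U σ → A.IsHol U τ → A.IsHol U υ →
    ∀ x ∈ U, A.bracket σ (A.bracket τ υ) x =
      A.bracket (A.bracket σ τ) υ x + A.bracket τ (A.bracket σ υ) x

/-- An isomorphism of Lie algebroids over the identity of `M`. -/
structure IsIso (A B : LieAlgebroidData I M) (ψ : ∀ x, A.Fib x ≃ₗ[ℂ] B.Fib x) : Prop where
  isHol_iff : ∀ (U : Set M) (σ : ∀ x, A.Fib x), IsOpen U →
    (A.IsHol U σ ↔ B.IsHol U fun x => ψ x (σ x))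
  anchor_eq : ∀ x v, B.anchor x (ψ x v) = A.anchor x v
  bracket_eq : ∀ (U : Set M) (σ τ : ∀ x, A.Fib x), IsOpen U → A.IsHol U σ → A.IsHol U τ →
    ∀ x ∈ U, ψ x (A.bracket σ τ x) = B.bracket (fun y => ψ y (σ y)) (fun y => ψ y (τ y)) x

/-- A closed holomorphic `2`-form on a Lie algebroid (a `2`-cocycle with trivial coefficients of
its Chevalley-Eilenberg complex). -/
structure IsClosedTwoForm (A : LieAlgebroidData I M)
    (w : ∀ x, A.Fib x →ₗ[ℂ] A.Fib x →ₗ[ℂ] ℂ) : Prop where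
  alternating : ∀ x v, w x v v = 0
  hol : ∀ (U : Set M) (σ τ : ∀ x, A.Fib x), IsOpen U → A.IsHol U σ → A.IsHol U τ →
    ContMDiffOn I 𝓘(ℂ, ℂ) ω (fun x => w x (σ x) (τ x)) U
  closed : ∀ (U : Set M) (σ τ υ : ∀ x, A.Fib x), IsOpen U →
    A.IsHol U σ → A.IsHol U τ → A.IsHol U υ → ∀ x ∈ U,
    A.deriv σ (fun y => w y (τ y) (υ y)) x - A.deriv τ (fun y => w y (σ y) (υ y)) x
      + A.deriv υ (fun y => w y (σ y) (τ y)) x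
      - w x (A.bracket σ τ x) (υ x) + w x (A.bracket σ υ x) (τ x)
      - w x (A.bracket τ υ x) (σ x) = 0

/-- The Lie algebroid `A ⊕ ℂ_M` defined by a `2`-form `w`, with bracket
`[(X, f), (Y, g)] = ([X, Y], a(X) g - a(Y) f + w(X, Y))` and anchor `(X, f) ↦ a(X)`. -/
def twist (A : LieAlgebroidData I M) (w : ∀ x, A.Fib x →ₗ[ℂ] A.Fib x →ₗ[ℂ] ℂ) :
    LieAlgebroidData I M where
  Fib x := A.Fib x × ℂ
  IsHol U σ := A.IsHol U (fun x => (σ x).1) ∧ ContMDiffOn I 𝓘(ℂ, ℂ) ω (fun x => (σ x).2) U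
  anchor x := A.anchor x ∘ₗ LinearMap.fst ℂ (A.Fib x) ℂ
  bracket σ τ x :=
    (A.bracket (fun y => (σ y).1) (fun y => (τ y).1) x,
      A.deriv (fun y => (σ y).1) (fun y => (τ y).2) x
        - A.deriv (fun y => (τ y).1) (fun y => (σ y).2) x + w x (σ x).1 (τ x).1)

/-- `0 → ℂ_M → B → A → 0`, with maps `i` and `p`, is a central extension of holomorphic Lie
algebroids; `ℂ_M` has the trivial representation `L_X f = a(X) f` of `A`. -/
structure IsCentralExtension [IsManifold I ω M] (B A : LieAlgebroidData I M)
    (i : ∀ x, ℂ →ₗ[ℂ] B.Fib x) (p : ∀ x, B.Fib x →ₗ[ℂ] A.Fib x) : Prop where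
  isLieAlgebroid_total : B.IsLieAlgebroid
  isLieAlgebroid_base : A.IsLieAlgebroid
  hol_incl : ∀ (U : Set M) (f : M → ℂ), IsOpen U → ContMDiffOn I 𝓘(ℂ, ℂ) ω f U →
    B.IsHol U fun x => i x (f x)
  hol_proj : ∀ (U : Set M) (σ : ∀ x, B.Fib x), IsOpen U → B.IsHol U σ →
    A.IsHol U fun x => p x (σ x)
  incl_injective : ∀ x, Function.Injective (i x)
  proj_surjective : ∀ x, Function.Surjective (p x)
  exact : ∀ x, LinearMap.range (i x) = LinearMap.ker (p x)
  anchor_proj : ∀ x v, A.anchor x (p x v) = B.anchor x v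
  bracket_proj : ∀ (U : Set M) (σ τ : ∀ x, B.Fib x), IsOpen U → B.IsHol U σ → B.IsHol U τ →
    ∀ x ∈ U, p x (B.bracket σ τ x) = A.bracket (fun y => p y (σ y)) (fun y => p y (τ y)) x
  incl_abelian : ∀ (U : Set M) (f g : M → ℂ), IsOpen U →
    ContMDiffOn I 𝓘(ℂ, ℂ) ω f U → ContMDiffOn I 𝓘(ℂ, ℂ) ω g U →
    ∀ x ∈ U, B.bracket (fun y => i y (f y)) (fun y => i y (g y)) x = 0
  central : ∀ (U : Set M) (f : M → ℂ) (σ : ∀ x, B.Fib x), IsOpen U →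
    ContMDiffOn I 𝓘(ℂ, ℂ) ω f U → B.IsHol U σ →
    ∀ x ∈ U, i x (A.deriv (fun y => p y (σ y)) f x) = B.bracket σ (fun y => i y (f y)) x

end LieAlgebroidData

/-! ### Holomorphic Lie groupoids -/

/-- The structure maps of a groupoid with objects `M` and arrows `G`.  The product `mul g h`
(first `h`, then `g`) is meaningful only when `src g = tgt h`. -/
structure GroupoidData (M G : Type) where
  src : G → M
  tgt : G → M
  one : M → G
  mul : G → G → G
  inv : G → G

namespace GroupoidData

section

variable {EM : Type} [NormedAddCommGroup EM] [NormedSpace ℂ EM]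
  {HM : Type} [TopologicalSpace HM] (IM : ModelWithCorners ℂ EM HM)
  {EG : Type} [NormedAddCommGroup EG] [NormedSpace ℂ EG]
  {HG : Type} [TopologicalSpace HG] (IG : ModelWithCorners ℂ EG HG)
  {M : Type} [TopologicalSpace M] [ChartedSpace HM M]
  {G : Type} [TopologicalSpace G] [ChartedSpace HG G]

/-- The axioms of a holomorphic Lie groupoid. -/
structure IsLieGroupoid (𝒢 : GroupoidData M G) : Prop where
  finiteDimensional_obj : FiniteDimensional ℂ EM
  finiteDimensional_arr : FiniteDimensional ℂ EG
  boundaryless_obj : IM.Boundaryless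
  boundaryless_arr : IG.Boundaryless
  isManifold_obj : IsManifold IM ω M
  isManifold_arr : IsManifold IG ω G
  src_one : ∀ x, 𝒢.src (𝒢.one x) = x
  tgt_one : ∀ x, 𝒢.tgt (𝒢.one x) = x
  src_mul : ∀ g h, 𝒢.src g = 𝒢.tgt h → 𝒢.src (𝒢.mul g h) = 𝒢.src h
  tgt_mul : ∀ g h, 𝒢.src g = 𝒢.tgt h → 𝒢.tgt (𝒢.mul g h) = 𝒢.tgt g
  mul_assoc : ∀ g h k, 𝒢.src g = 𝒢.tgt h → 𝒢.src h = 𝒢.tgt k →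
    𝒢.mul (𝒢.mul g h) k = 𝒢.mul g (𝒢.mul h k)
  one_mul : ∀ g, 𝒢.mul (𝒢.one (𝒢.tgt g)) g = g
  mul_one : ∀ g, 𝒢.mul g (𝒢.one (𝒢.src g)) = g
  src_inv : ∀ g, 𝒢.src (𝒢.inv g) = 𝒢.tgt g
  tgt_inv : ∀ g, 𝒢.tgt (𝒢.inv g) = 𝒢.src g
  inv_mul : ∀ g, 𝒢.mul (𝒢.inv g) g = 𝒢.one (𝒢.src g)
  mul_inv : ∀ g, 𝒢.mul g (𝒢.inv g) = 𝒢.one (𝒢.tgt g)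
  src_submersion : Manifold.IsSubmersion IG IM ω 𝒢.src
  tgt_submersion : Manifold.IsSubmersion IG IM ω 𝒢.tgt
  one_hol : ContMDiff IM IG ω 𝒢.one
  inv_hol : ContMDiff IG IG ω 𝒢.inv
  mul_hol : ContMDiffOn (IG.prod IG) IG ω (fun q : G × G => 𝒢.mul q.1 q.2)
    {q | 𝒢.src q.1 = 𝒢.tgt q.2}

/-- The differential at the unit of right translation by `g`, a map from the source fibre through
`one (tgt g)` to the source fibre through `g`.  It is only meaningful on vectors tangent to the
source fibre. -/
def rightTranslate (𝒢 : GroupoidData M G) (g : G) (v : TangentSpace IG (𝒢.one (𝒢.tgt g))) :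
    TangentSpace IG g :=
  (mfderivWithin IG IG (fun h => 𝒢.mul h g) (𝒢.src ⁻¹' {𝒢.tgt g}) (𝒢.one (𝒢.tgt g)) v : EG)

/-- The right-invariant vector field on `G`, tangent to the source fibres, that extends a family of
vectors along the units. -/
def rightInvariant (𝒢 : GroupoidData M G) (σ : ∀ x, TangentSpace IG (𝒢.one x)) :
    ∀ g : G, TangentSpace IG g :=
  fun g => 𝒢.rightTranslate IG g (σ (𝒢.tgt g))

open Classical in
/-- The Lie algebroid of a Lie groupoid: the fibre at `x` is the tangent space at the unit of the
source fibre, the anchor is the differential of the target map, and the bracket is the Lie bracket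
of right-invariant vector fields. -/
def lieAlgebroid [IsManifold IG ω G] (𝒢 : GroupoidData M G) : LieAlgebroidData IM M where
  Fib x := LinearMap.ker (mfderiv IG IM 𝒢.src (𝒢.one x)).toLinearMap
  IsHol U σ := ContMDiffOn IM IG.tangent ω
    (fun x => (⟨𝒢.one x, (σ x).1⟩ : TangentBundle IG G)) U
  anchor x := LinearMap.comp (M₃ := EM) (mfderiv IG IM 𝒢.tgt (𝒢.one x)).toLinearMap
    (Submodule.subtype _)
  bracket σ τ x :=
    if h : VectorField.mlieBracket IG (𝒢.rightInvariant IG fun y => (σ y).1)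
        (𝒢.rightInvariant IG fun y => (τ y).1) (𝒢.one x) ∈
        LinearMap.ker (mfderiv IG IM 𝒢.src (𝒢.one x)).toLinearMap
    then ⟨_, h⟩ else 0

end

/-- The action groupoid `K ⋉ M ⇉ M` of a group action, with source `(g, x) ↦ x` and target
`(g, x) ↦ g • x`. -/
def action {K M : Type} [Group K] (act : K →* Equiv.Perm M) : GroupoidData M (K × M) where
  src g := g.2
  tgt g := act g.1 g.2
  one x := (1, x)
  mul g h := (g.1 * h.1, h.2)
  inv g := (g.1⁻¹, act g.1 g.2)

/-- The trivial family of groups `ℂ_M = M × ℂ` over `M`, as a groupoid over `M`. -/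
def trivialFamily (M : Type) : GroupoidData M (M × ℂ) where
  src m := m.1
  tgt m := m.1
  one x := (x, 0)
  mul m n := (n.1, m.2 + n.2)
  inv m := (m.1, -m.2)

section

variable {EM : Type} [NormedAddCommGroup EM] [NormedSpace ℂ EM]
  {HM : Type} [TopologicalSpace HM] (IM : ModelWithCorners ℂ EM HM)
  {EE : Type} [NormedAddCommGroup EE] [NormedSpace ℂ EE]
  {HE : Type} [TopologicalSpace HE] (IE : ModelWithCorners ℂ EE HE)
  {EG : Type} [NormedAddCommGroup EG] [NormedSpace ℂ EG]
  {HG : Type} [TopologicalSpace HG] (IG : ModelWithCorners ℂ EG HG)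
  {M : Type} [TopologicalSpace M] [ChartedSpace HM M]
  {T : Type} [TopologicalSpace T] [ChartedSpace HE T]
  {G : Type} [TopologicalSpace G] [ChartedSpace HG G]

/-- A holomorphic morphism of groupoids that is the identity on objects. -/
structure IsMorphism (𝒯 : GroupoidData M T) (𝒢 : GroupoidData M G) (φ : T → G) : Prop where
  hol : ContMDiff IE IG ω φ
  src : ∀ e, 𝒢.src (φ e) = 𝒯.src e
  tgt : ∀ e, 𝒢.tgt (φ e) = 𝒯.tgt e
  one : ∀ x, φ (𝒯.one x) = 𝒢.one x
  mul : ∀ e f, 𝒯.src e = 𝒯.tgt f → φ (𝒯.mul e f) = 𝒢.mul (φ e) (φ f)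

/-- `0 → ℂ_M → 𝒯 → 𝒢 → 0`, with maps `i` and `p`, is a central extension of holomorphic Lie
groupoids over `M`; `ℂ_M` is the trivial `𝒢`-module. -/
structure IsCentralExtension (𝒯 : GroupoidData M T) (𝒢 : GroupoidData M G)
    (i : M × ℂ → T) (p : T → G) : Prop where
  isLieGroupoid_kernel : (trivialFamily M).IsLieGroupoid IM (IM.prod 𝓘(ℂ, ℂ))
  isLieGroupoid_total : 𝒯.IsLieGroupoid IM IE
  isLieGroupoid_base : 𝒢.IsLieGroupoid IM IG
  incl_morphism : IsMorphism (IM.prod 𝓘(ℂ, ℂ)) IE (trivialFamily M) 𝒯 i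
  proj_morphism : IsMorphism IE IG 𝒯 𝒢 p
  incl_embedding : Manifold.IsSmoothEmbedding (IM.prod 𝓘(ℂ, ℂ)) IE ω i
  proj_surjective : Function.Surjective p
  proj_submersion : Manifold.IsSubmersion IE IG ω p
  exact : Set.range i = {e | ∃ x, p e = 𝒢.one x}
  /-- `e ι(m) = ι(π(e) · m) e`, where `π(e) · (s(e), c) = (t(e), c)`. -/
  central : ∀ e c, 𝒯.mul e (i (𝒯.src e, c)) = 𝒯.mul (i (𝒯.tgt e, c)) e
  /-- The right action of `ℂ_M` is simply transitive on the fibres of `p`. -/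
  principal : ∀ e e', p e = p e' → ∃! c, e' = 𝒯.mul e (i (𝒯.src e, c))
  /-- `p` is locally trivial as a principal bundle. -/
  locally_trivial : ∀ g, ∃ (U : Set G) (s : G → T) (c : T → ℂ), IsOpen U ∧ g ∈ U ∧
    ContMDiffOn IG IE ω s U ∧ ContMDiffOn IE 𝓘(ℂ, ℂ) ω c (p ⁻¹' U) ∧
    (∀ h ∈ U, p (s h) = h) ∧
    ∀ e, p e ∈ U → e = 𝒯.mul (s (p e)) (i (𝒯.src e, c e))

/-- The extension `0 → ℂ_M → 𝒯 → 𝒢 → 0` of Lie groupoids (maps `i`, `p`) integrates the extension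
`0 → ℂ_M → B → A → 0` of Lie algebroids (maps `j`, `q`): the Lie functor takes the former to an
extension isomorphic to the latter, where the Lie algebroid of the family of groups `ℂ_M` is
identified with the trivial line bundle by `c ↦ (0, c)`, a vector tangent to `M × ℂ` at `(x, 0)`. -/
def Integrates [IsManifold IE ω T] [IsManifold IG ω G]
    (𝒯 : GroupoidData M T) (𝒢 : GroupoidData M G) (i : M × ℂ → T) (p : T → G)
    (B A : LieAlgebroidData IM M) (j : ∀ x, ℂ →ₗ[ℂ] B.Fib x)
    (q : ∀ x, B.Fib x →ₗ[ℂ] A.Fib x) : Prop :=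
  ∃ (ψB : ∀ x, B.Fib x ≃ₗ[ℂ] (𝒯.lieAlgebroid IM IE).Fib x)
    (ψA : ∀ x, A.Fib x ≃ₗ[ℂ] (𝒢.lieAlgebroid IM IG).Fib x),
    LieAlgebroidData.IsIso B (𝒯.lieAlgebroid IM IE) ψB ∧
    LieAlgebroidData.IsIso A (𝒢.lieAlgebroid IM IG) ψA ∧
    (∀ x (c : ℂ), ((ψB x (j x c)).1 : EE) =
      mfderiv (IM.prod 𝓘(ℂ, ℂ)) IE i (x, 0) ((0, c) : EM × ℂ)) ∧
    ∀ x (v : B.Fib x), ((ψA x (q x v)).1 : EG) = mfderiv IE IG p (𝒯.one x) (ψB x v).1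

end

end GroupoidData

/-! ### The logarithmic tangent algebroid of `(ℂ², xy = 0)` -/

/-- A vector field `X` on `U ⊆ ℂ²` is tangent to the divisor `xy = 0`: `X(xy)` vanishes on it. -/
def IsTangentToDivisor (U : Set (ℂ × ℂ)) (X : ℂ × ℂ → ℂ × ℂ) : Prop :=
  ∀ q ∈ U, q.1 * q.2 = 0 → fderiv ℂ (fun r : ℂ × ℂ => r.1 * r.2) q (X q) = 0

/-- `A` is the Lie algebroid `T(-log D)` for `D = {xy = 0}`: the anchor identifies its sections over
any open `U` with the holomorphic vector fields on `U` that are tangent to `D`, and its bracket with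
the Lie bracket of vector fields. -/
structure IsLogTangentAlgebroid (A : LieAlgebroidData 𝓘(ℂ, ℂ × ℂ) (ℂ × ℂ)) : Prop where
  isLieAlgebroid : A.IsLieAlgebroid
  anchor_tangent : ∀ (U : Set (ℂ × ℂ)) (σ : ∀ x, A.Fib x), IsOpen U → A.IsHol U σ →
    ContDiffOn ℂ ω (fun x => (A.anchor x (σ x) : ℂ × ℂ)) U ∧
    IsTangentToDivisor U fun x => A.anchor x (σ x)
  anchor_injective : ∀ (U : Set (ℂ × ℂ)) (σ τ : ∀ x, A.Fib x), IsOpen U →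
    A.IsHol U σ → A.IsHol U τ → (∀ x ∈ U, A.anchor x (σ x) = A.anchor x (τ x)) →
    ∀ x ∈ U, σ x = τ x
  anchor_surjective : ∀ (U : Set (ℂ × ℂ)) (X : ℂ × ℂ → ℂ × ℂ), IsOpen U → ContDiffOn ℂ ω X U →
    IsTangentToDivisor U X → ∃ σ, A.IsHol U σ ∧ ∀ x ∈ U, A.anchor x (σ x) = X x
  anchor_bracket : ∀ (U : Set (ℂ × ℂ)) (σ τ : ∀ x, A.Fib x), IsOpen U →
    A.IsHol U σ → A.IsHol U τ → ∀ x ∈ U, A.anchor x (A.bracket σ τ x) =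
      VectorField.lieBracket ℂ (fun y => (A.anchor y (σ y) : ℂ × ℂ))
        (fun y => (A.anchor y (τ y) : ℂ × ℂ)) x

/-- The anchor of `logTangent`: `(u, v) ↦ u x ∂_x + v y ∂_y`. -/
def logAnchor (x : ℂ × ℂ) : ℂ × ℂ →ₗ[ℂ] ℂ × ℂ :=
  (LinearMap.mulLeft ℂ x.1).prodMap (LinearMap.mulLeft ℂ x.2)

/-- The Lie algebroid `T(-log D)` on `ℂ²` for `D = {xy = 0}`, in the frame `x ∂_x`, `y ∂_y`: the
section `(u, v)` stands for the vector field `u x ∂_x + v y ∂_y`. -/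
def logTangent : LieAlgebroidData 𝓘(ℂ, ℂ × ℂ) (ℂ × ℂ) where
  Fib _ := ℂ × ℂ
  IsHol U σ := ContDiffOn ℂ ω σ U
  anchor x := logAnchor x
  bracket σ τ x :=
    fderiv ℂ τ x (logAnchor x (σ x)) - fderiv ℂ σ x (logAnchor x (τ x))

/-- The alternating form `(u, v), (u', v') ↦ u v' - v u'` on `ℂ²`. -/
def frameForm : ℂ × ℂ →ₗ[ℂ] ℂ × ℂ →ₗ[ℂ] ℂ :=
  LinearMap.mk₂ ℂ (fun v w => v.1 * w.2 - v.2 * w.1)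
    (by intros; simp; ring) (by intros; simp; ring) (by intros; simp; ring) (by intros; simp; ring)

/-- The logarithmic form `dx ∧ dy / (xy)` on `T(-log D)`: it takes the value `1` on the frame
`x ∂_x`, `y ∂_y`. -/
def logForm (x : ℂ × ℂ) : logTangent.Fib x →ₗ[ℂ] logTangent.Fib x →ₗ[ℂ] ℂ :=
  frameForm

/-! ### The complex Heisenberg group and its action on `ℂ²` -/

/-- The complex Heisenberg group, in the global holomorphic coordinates `(a, b, c)`. -/
def Heis : Type := ℂ × ℂ × ℂ

namespace Heis

instance : TopologicalSpace Heis := inferInstanceAs (TopologicalSpace (ℂ × ℂ × ℂ))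

instance : ChartedSpace (ℂ × ℂ × ℂ) Heis := chartedSpaceSelf (ℂ × ℂ × ℂ)

instance : IsManifold 𝓘(ℂ, ℂ × ℂ × ℂ) ω Heis :=
  inferInstanceAs (IsManifold 𝓘(ℂ, ℂ × ℂ × ℂ) ω (ℂ × ℂ × ℂ))

def a (g : Heis) : ℂ := g.1
def b (g : Heis) : ℂ := g.2.1
def c (g : Heis) : ℂ := g.2.2

@[ext] theorem ext {g h : Heis} (ha : g.a = h.a) (hb : g.b = h.b) (hc : g.c = h.c) : g = h :=
  Prod.ext ha (Prod.ext hb hc)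

instance : Mul Heis := ⟨fun g h => (g.a + h.a, g.b + h.b, g.c + h.c + g.a * h.b)⟩
instance : One Heis := ⟨((0 : ℂ), (0 : ℂ), (0 : ℂ))⟩
instance : Inv Heis := ⟨fun g => (-g.a, -g.b, -g.c + g.a * g.b)⟩

@[simp] theorem mul_a (g h : Heis) : (g * h).a = g.a + h.a := rfl
@[simp] theorem mul_b (g h : Heis) : (g * h).b = g.b + h.b := rfl
@[simp] theorem mul_c (g h : Heis) : (g * h).c = g.c + h.c + g.a * h.b := rfl
@[simp] theorem one_a : (1 : Heis).a = 0 := rfl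
@[simp] theorem one_b : (1 : Heis).b = 0 := rfl
@[simp] theorem one_c : (1 : Heis).c = 0 := rfl
@[simp] theorem inv_a (g : Heis) : g⁻¹.a = -g.a := rfl
@[simp] theorem inv_b (g : Heis) : g⁻¹.b = -g.b := rfl
@[simp] theorem inv_c (g : Heis) : g⁻¹.c = -g.c + g.a * g.b := rfl

instance : Group Heis :=
  Group.ofLeftAxioms
    (by intro g h k; ext <;> simp <;> ring)
    (by intro g; ext <;> simp)
    (by intro g; ext <;> simp)

/-- The matrix with coordinates `(a, b, c)`. -/
def toMatrix (g : Heis) : Matrix (Fin 3) (Fin 3) ℂ :=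
  !![1, g.a, g.c; 0, 1, g.b; 0, 0, 1]

/-- The action `(a, b, c) · (x, y) = (eᵃ x, eᵇ y)` of the Heisenberg group on `ℂ²`. -/
def act : Heis →* Equiv.Perm (ℂ × ℂ) where
  toFun g :=
    { toFun := fun x => (Complex.exp g.a * x.1, Complex.exp g.b * x.2)
      invFun := fun x => (Complex.exp (-g.a) * x.1, Complex.exp (-g.b) * x.2)
      left_inv := fun x => by simp [← mul_assoc, ← Complex.exp_add]
      right_inv := fun x => by simp [← mul_assoc, ← Complex.exp_add] }
  map_one' := by ext x <;> simp
  map_mul' g h := by ext x <;> simp [Complex.exp_add, mul_assoc]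

end Heis

/-- The additive group `ℂ²`, written multiplicatively, as a complex manifold. -/
def AddC2 : Type := Multiplicative (ℂ × ℂ)

namespace AddC2

instance : CommGroup AddC2 := inferInstanceAs (CommGroup (Multiplicative (ℂ × ℂ)))

instance : TopologicalSpace AddC2 := inferInstanceAs (TopologicalSpace (ℂ × ℂ))

instance : ChartedSpace (ℂ × ℂ) AddC2 := chartedSpaceSelf (ℂ × ℂ)

instance : IsManifold 𝓘(ℂ, ℂ × ℂ) ω AddC2 :=
  inferInstanceAs (IsManifold 𝓘(ℂ, ℂ × ℂ) ω (ℂ × ℂ))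

/-- The element `(a, b)`. -/
def of (v : ℂ × ℂ) : AddC2 := Multiplicative.ofAdd v

/-- The coordinates `(a, b)` of an element. -/
def val (g : AddC2) : ℂ × ℂ := Multiplicative.toAdd g

@[simp] theorem val_one : (1 : AddC2).val = 0 := rfl
@[simp] theorem val_mul (g h : AddC2) : (g * h).val = g.val + h.val := rfl

/-- The action `(a, b) · (x, y) = (eᵃ x, eᵇ y)` of `ℂ²` on itself. -/
def act : AddC2 →* Equiv.Perm (ℂ × ℂ) where
  toFun g :=
    { toFun := fun x => (Complex.exp g.val.1 * x.1, Complex.exp g.val.2 * x.2)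
      invFun := fun x => (Complex.exp (-g.val.1) * x.1, Complex.exp (-g.val.2) * x.2)
      left_inv := fun x => by simp [← mul_assoc, ← Complex.exp_add]
      right_inv := fun x => by simp [← mul_assoc, ← Complex.exp_add] }
  map_one' := by ext x <;> simp
  map_mul' g h := by ext x <;> simp [Complex.exp_add, mul_assoc]

end AddC2

/-- The inclusion `ℂ_{ℂ²} → H ⋉ ℂ²`, `(x, c) ↦ ((0, 0, ε c), x)`. -/
def heisIncl (ε : ℂ) (m : (ℂ × ℂ) × ℂ) : Heis × (ℂ × ℂ) :=
  (((0 : ℂ), (0 : ℂ), ε * m.2), m.1)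

/-- The projection `H ⋉ ℂ² → ℂ² ⋉ ℂ²`, `((a, b, c), x) ↦ ((a, b), x)`. -/
def heisProj (g : Heis × (ℂ × ℂ)) : AddC2 × (ℂ × ℂ) :=
  (AddC2.of (g.1.a, g.1.b), g.2)

end

/-!
The frame `x ∂_x`, `y ∂_y` of `T(-log D)` commutes, so in coefficients its bracket is
`[σ, τ] = σ(τ) - τ(σ)`, where a section acts on functions through the vector field it stands for
(`logDerivation`). The one analytic point is that this frame generates: a vector field tangent to
`D` has its first component divisible by `x` and its second by `y`. On the divisor minus the origin
vanishing is the definition of tangency, at the origin it follows by continuity, and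
`exists_contDiffOn_eq_fst_mul` performs the division by Hadamard's formula
`f (x, y) = x * ∫₀¹ ∂ₓf (t x, y) dt`. In this frame `dx ∧ dy / (xy)` has constant coefficients and is
closed (`isClosedTwoForm_logForm`); a closed `2`-form on a Lie algebroid always defines a central
extension, its closedness being the Jacobi identity (`LieAlgebroidData.IsLieAlgebroid.twist`).

On the global side everything happens on the vector spaces `ℂ³ × ℂ²` and `ℂ² × ℂ²`, and for either
inclusion of the centre the groupoid sequence is, up to the group law, a split sequence of linear
maps (`heis_isCentralExtension`). Let a group with underlying manifold a vector space `V` act on a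
vector space `W`. The Lie algebroid of the action groupoid has fibres `V`, its anchor is the
infinitesimal action, and a section `s : W → V` gives the right-invariant vector field
`(g, x) ↦ (dR_g (s (g • x)), 0)`. Differentiating it at a unit, `bracket_action` finds
`[s, t] = s(t) - t(s) + (dR' s t - dR' t s)`, with `dR'` the derivative at the identity of
`g ↦ dR_g`. For the group `ℂ²` the last term vanishes and the bracket is that of `T(-log D)`. For the
Heisenberg group `dR_g (k) = (k_a, k_b, k_c + k_a g_b)`, so the last term is
`(0, 0, t_a s_b - s_a t_b)`, that is, minus the form `dx ∧ dy / (xy)` on the logarithmic coefficients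
of `s` and `t`. Hence the centre has to be included by `c ↦ -c` to integrate `dx ∧ dy / (xy)`, and
the inclusion `c ↦ c` integrates its negative (`heis_integrates`).
-/

noncomputable section

/-! ### Manifold notions on vector spaces with product charts -/

section FlatModels

variable {E : Type} [NormedAddCommGroup E] [NormedSpace ℂ E]
  {F : Type} [NormedAddCommGroup F] [NormedSpace ℂ F]

/-- The model and the charts of a product of vector spaces equal, but do not unfold to, those of the
product as a vector space. This lemma and the following ones therefore take them as variables,
together with equations. -/
theorem mfderiv_eq_fderiv_of_eq_self
    {I : ModelWithCorners ℂ E E} {cE : ChartedSpace E E} {J : ModelWithCorners ℂ F F}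
    {cF : ChartedSpace F F} (hI : I = 𝓘(ℂ, E)) (hcE : cE = chartedSpaceSelf E)
    (hJ : J = 𝓘(ℂ, F)) (hcF : cF = chartedSpaceSelf F) (f : E → F) (x : E) :
    (mfderiv I J f x : E →L[ℂ] F) = fderiv ℂ f x := by
  subst hI hcE hJ hcF
  exact mfderiv_eq_fderiv

theorem contMDiff_iff_contDiff_of_eq_self
    {I : ModelWithCorners ℂ E E} {cE : ChartedSpace E E} {J : ModelWithCorners ℂ F F}
    {cF : ChartedSpace F F} (hI : I = 𝓘(ℂ, E)) (hcE : cE = chartedSpaceSelf E)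
    (hJ : J = 𝓘(ℂ, F)) (hcF : cF = chartedSpaceSelf F) {f : E → F} :
    ContMDiff I J ω f ↔ ContDiff ℂ ω f := by
  subst hI hcE hJ hcF
  exact contMDiff_iff_contDiff

/-- A map of vector spaces that is a linear projection after a global biholomorphism of its source is
a submersion. -/
theorem isSubmersion_of_eq_self {K : Type} [NormedAddCommGroup K] [NormedSpace ℂ K]
    {I : ModelWithCorners ℂ E E} {cE : ChartedSpace E E} {J : ModelWithCorners ℂ F F}
    {cF : ChartedSpace F F} (hI : I = 𝓘(ℂ, E)) (hcE : cE = chartedSpaceSelf E)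
    (hJ : J = 𝓘(ℂ, F)) (hcF : cF = chartedSpaceSelf F)
    (Φ : E ≃ E) (hΦ : ContDiff ℂ ω Φ) (hΦs : ContDiff ℂ ω Φ.symm) (e : E ≃L[ℂ] F × K)
    {f : E → F} (hf : ∀ x, f x = (e (Φ x)).1) : Manifold.IsSubmersion I J ω f := by
  subst hI hcE hJ hcF
  let Ψ : E ≃ₜ E := ⟨Φ, hΦ.continuous, hΦs.continuous⟩
  refine ⟨K, inferInstance, inferInstance, fun x => ?_⟩
  refine .mk_of_charts e Ψ.toOpenPartialHomeomorph (OpenPartialHomeomorph.refl F) (by simp)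
    (by simp) ?_ ?_ (by simp) ?_
  · rw [IsManifold.mem_maximalAtlas_iff_contMDiffOn]
    exact ⟨hΦ.contMDiff.contMDiffOn, hΦs.contMDiff.contMDiffOn⟩
  · exact (contDiffGroupoid ω 𝓘(ℂ, F)).id_mem_maximalAtlas
  · intro y _
    simp [Ψ, hf]

theorem isSmoothEmbedding_of_eq_self {K : Type} [NormedAddCommGroup K] [NormedSpace ℂ K]
    {I : ModelWithCorners ℂ E E} {cE : ChartedSpace E E} {J : ModelWithCorners ℂ F F}
    {cF : ChartedSpace F F} (hI : I = 𝓘(ℂ, E)) (hcE : cE = chartedSpaceSelf E)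
    (hJ : J = 𝓘(ℂ, F)) (hcF : cF = chartedSpaceSelf F) (e : (E × K) ≃L[ℂ] F)
    {f : E → F} (hf : ∀ x, f x = e (x, 0)) : Manifold.IsSmoothEmbedding I J ω f := by
  subst hI hcE hJ hcF
  obtain rfl : f = fun x => e (x, 0) := funext hf
  refine ⟨⟨K, inferInstance, inferInstance, fun x => ?_⟩, ?_⟩
  · refine .mk_of_charts e (OpenPartialHomeomorph.refl E) (OpenPartialHomeomorph.refl F) (by simp)
      (by simp) ?_ ?_ (by simp) ?_
    · exact (contDiffGroupoid ω 𝓘(ℂ, E)).id_mem_maximalAtlas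
    · exact (contDiffGroupoid ω 𝓘(ℂ, F)).id_mem_maximalAtlas
    · intro y _
      simp
  · exact e.toHomeomorph.isEmbedding.comp (Topology.IsEmbedding.of_leftInverse (f := Prod.fst)
      (fun _ => rfl) continuous_fst (by fun_prop))

theorem mlieBracket_eq_lieBracket_of_eq_self
    {I : ModelWithCorners ℂ E E} {cE : ChartedSpace E E} (hI : I = 𝓘(ℂ, E))
    (hcE : cE = chartedSpaceSelf E) (V W : E → E) (x : E) :
    (VectorField.mlieBracket I (M := E) V W x : E) = VectorField.lieBracket ℂ V W x := by
  subst hI hcE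
  exact (congrFun (VectorField.mlieBracketWithin_univ (I := 𝓘(ℂ, E)) (M := E)
    (V := V) (W := W)).symm x).trans
    ((congrFun (VectorField.mlieBracketWithin_eq_lieBracketWithin (V := V) (W := W)
      (s := Set.univ)) x).trans (congrFun VectorField.lieBracketWithin_univ x))

/-- A map into the tangent bundle of a vector space is holomorphic iff its base point and its
vector part are. -/
theorem contMDiffOn_tangent_iff_of_eq_self
    {I : ModelWithCorners ℂ E E} {cE : ChartedSpace E E} {J : ModelWithCorners ℂ F F}
    {cF : ChartedSpace F F} [IsManifold J ω F] (hI : I = 𝓘(ℂ, E)) (hcE : cE = chartedSpaceSelf E)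
    (hJ : J = 𝓘(ℂ, F)) (hcF : cF = chartedSpaceSelf F) {f v : E → F} {s : Set E}
    (hf : ContDiff ℂ ω f) :
    ContMDiffOn I J.tangent ω (fun x => (⟨f x, v x⟩ : TangentBundle J F)) s ↔
      ContDiffOn ℂ ω v s := by
  subst hI hcE hJ hcF
  refine ⟨fun h => ?_, fun h x hx => ?_⟩
  · exact ((contMDiff_snd_tangentBundle_modelSpace F 𝓘(ℂ, F)).comp_contMDiffOn h).contDiffOn
  · refine Bundle.contMDiffWithinAt_totalSpace.2 ⟨hf.contMDiff x |>.contMDiffWithinAt, ?_⟩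
    convert! (h x hx).contMDiffWithinAt with y
    simp

end FlatModels

/-! ### Division of holomorphic functions by a coordinate -/

section Division

/-- The average of an analytic function over a path of linear contractions is analytic: the
homogeneous terms of its Taylor series are the averages of those of the function. -/
theorem AnalyticAt.intervalIntegral_comp_clm {E F : Type*} [NormedAddCommGroup E]
    [NormedSpace ℂ E] [NormedAddCommGroup F] [NormedSpace ℂ F] [CompleteSpace F] {g : E → F}
    (hg : AnalyticAt ℂ g 0) {A : ℝ → E →L[ℂ] E} (hA : Continuous A)
    (hA1 : ∀ t ∈ Set.Icc (0 : ℝ) 1, ‖A t‖ ≤ 1) :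
    AnalyticAt ℂ (fun v => ∫ t in (0 : ℝ)..1, g (A t v)) 0 := by
  obtain ⟨p, r, hp⟩ := hg
  have hIoc : Set.uIoc (0 : ℝ) 1 ⊆ Set.Icc 0 1 := by
    rw [Set.uIoc_of_le zero_le_one]; exact Set.Ioc_subset_Icc_self
  let P : ∀ n, ℝ → ContinuousMultilinearMap ℂ (fun _ : Fin n => E) F :=
    fun n t => (p n).compContinuousLinearMap fun _ => A t
  have hP : ∀ n, Continuous (P n) := by
    intro n
    have h := (ContinuousMultilinearMap.compContinuousLinearMapContinuousMultilinear ℂ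
      (fun _ : Fin n => E) (fun _ : Fin n => E) F).cont
    exact (h.comp (continuous_pi fun _ => hA)).clm_apply continuous_const
  have hP1 : ∀ n, ∀ t ∈ Set.Icc (0 : ℝ) 1, ‖P n t‖ ≤ ‖p n‖ := by
    intro n t ht
    refine ((p n).norm_compContinuousLinearMap_le _).trans ?_
    refine mul_le_of_le_one_right (norm_nonneg _) ?_
    exact Finset.prod_le_one (fun _ _ => norm_nonneg _) fun _ _ => hA1 t ht
  let q : FormalMultilinearSeries ℂ E F := fun n => ∫ t in (0 : ℝ)..1, P n t
  have hq : ∀ n, ‖q n‖ ≤ ‖p n‖ := by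
    intro n
    have := intervalIntegral.norm_integral_le_of_norm_le_const (a := 0) (b := 1) (f := P n)
      (C := ‖p n‖) fun t ht => hP1 n t (hIoc ht)
    simpa using this
  refine ⟨q, r, hp.r_le.trans (FormalMultilinearSeries.radius_le_of_le hq), hp.r_pos, ?_⟩
  intro y hy
  have hyr : y ∈ Metric.eball (0 : E) p.radius := Metric.eball_subset_eball hp.r_le hy
  have hsum : Summable fun n => ‖p n‖ * ‖y‖ ^ n := by
    have := p.summable_norm_mul_pow (r := ‖y‖₊) (by simpa [enorm_eq_nnnorm] using hyr)
    simpa using this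
  have hAy : ∀ t ∈ Set.Icc (0 : ℝ) 1, ‖A t y‖ ≤ ‖y‖ := fun t ht =>
    ((A t).le_of_opNorm_le (hA1 t ht) y).trans_eq (one_mul _)
  have key : HasSum (fun n => ∫ t in (0 : ℝ)..1, P n t fun _ => y)
      (∫ t in (0 : ℝ)..1, g (A t y)) := by
    refine intervalIntegral.hasSum_integral_of_dominated_convergence
      (fun n _ => ‖p n‖ * ‖y‖ ^ n) ?_ ?_ ?_ ?_ ?_
    · intro n
      have : Continuous fun t => P n t fun _ => y :=
        ((ContinuousMultilinearMap.apply ℂ (fun _ : Fin n => E) F fun _ => y).continuous).comp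
          (hP n)
      exact this.aestronglyMeasurable
    · intro n
      refine Filter.Eventually.of_forall fun t ht => ?_
      refine ((P n t).le_opNorm _).trans ?_
      simpa using mul_le_mul_of_nonneg_right (hP1 n t (hIoc ht)) (by positivity)
    · exact Filter.Eventually.of_forall fun _ _ => hsum
    · exact intervalIntegrable_const
    · refine Filter.Eventually.of_forall fun t ht => ?_
      have hmem : A t y ∈ Metric.eball (0 : E) r := by
        have h1 : ‖A t y‖ₑ ≤ ‖y‖ₑ := enorm_le_iff_norm_le.2 (hAy t (hIoc ht))
        simp only [Metric.mem_eball, edist_zero_right] at hy ⊢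
        exact h1.trans_lt hy
      simpa [P] using hp.hasSum hmem
  rw [zero_add]
  convert key using 2 with n
  exact (ContinuousLinearMap.intervalIntegral_comp_comm
    (ContinuousMultilinearMap.apply ℂ (fun _ : Fin n => E) F fun _ => y)
    ((hP n).intervalIntegrable 0 1)).symm

/-- A holomorphic function that vanishes on the hyperplane `x = 0` is divisible by `x`. -/
theorem exists_contDiffOn_eq_fst_mul {F : Type*} [NormedAddCommGroup F] [NormedSpace ℂ F]
    {U : Set (ℂ × F)} (hU : IsOpen U) {f : ℂ × F → ℂ} (hf : ContDiffOn ℂ ω f U)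
    (h0 : ∀ q ∈ U, q.1 = 0 → f q = 0) :
    ∃ g : ℂ × F → ℂ, ContDiffOn ℂ ω g U ∧ ∀ q ∈ U, f q = q.1 * g q := by
  classical
  have hfU : AnalyticOnNhd ℂ f U :=
    hU.analyticOn_iff_analyticOnNhd.1 ((contDiffOn_omega_iff_analyticOn hU.uniqueDiffOn).1 hf)
  let e : ℂ × F := (1, 0)
  let A : ℝ → (ℂ × F) →L[ℂ] (ℂ × F) := fun t =>
    ((t : ℂ) • ContinuousLinearMap.fst ℂ ℂ F).prod (ContinuousLinearMap.snd ℂ ℂ F)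
  have hA : Continuous A := by
    have : A = fun t : ℝ => (t : ℂ) • ((ContinuousLinearMap.fst ℂ ℂ F).prod 0)
        + (0 : (ℂ × F) →L[ℂ] ℂ).prod (ContinuousLinearMap.snd ℂ ℂ F) := by
      ext t v <;> simp [A]
    rw [this]
    fun_prop
  have hA1 : ∀ t ∈ Set.Icc (0 : ℝ) 1, ‖A t‖ ≤ 1 := by
    intro t ht
    refine ContinuousLinearMap.opNorm_le_bound _ zero_le_one fun v => ?_
    rw [one_mul]
    refine max_le ?_ (norm_snd_le v)
    have : ‖(t : ℂ)‖ ≤ 1 := by simpa [abs_of_nonneg ht.1] using ht.2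
    calc ‖(t : ℂ) * v.1‖ ≤ 1 * ‖v.1‖ := by rw [norm_mul]; gcongr
      _ ≤ ‖v‖ := by rw [one_mul]; exact norm_fst_le v
  -- Hadamard's integral formula for the quotient near a point of the hyperplane
  have hloc : ∀ q₀ ∈ U, q₀.1 = 0 → ∃ g : ℂ × F → ℂ, AnalyticAt ℂ g q₀ ∧
      ∀ᶠ q in 𝓝 q₀, f q = q.1 * g q := by
    intro q₀ hq₀ hq₀1
    have hfd : AnalyticAt ℂ (fun v => fderiv ℂ f (q₀ + v) e) 0 := by
      have h1 : AnalyticAt ℂ (fun q => fderiv ℂ f q e) (q₀ + 0) := by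
        rw [add_zero]
        exact ((ContinuousLinearMap.apply ℂ ℂ e).analyticAt _).comp (hfU q₀ hq₀).fderiv
      exact h1.fun_comp (by fun_prop)
    have hg := hfd.intervalIntegral_comp_clm hA hA1
    refine ⟨fun q => ∫ t in (0 : ℝ)..1, fderiv ℂ f (q₀ + A t (q - q₀)) e, ?_, ?_⟩
    · have : AnalyticAt ℂ (fun q : ℂ × F => q - q₀) q₀ := by fun_prop
      exact AnalyticAt.fun_comp (x := q₀) (f := fun q => q - q₀) (by rwa [sub_self]) this
    · obtain ⟨ε, hε, hball⟩ := Metric.isOpen_iff.1 hU q₀ hq₀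
      filter_upwards [Metric.ball_mem_nhds q₀ hε] with q hq
      have hmem : ∀ t ∈ Set.uIcc (0 : ℝ) 1, q₀ + A t (q - q₀) ∈ U := by
        intro t ht
        rw [Set.uIcc_of_le zero_le_one] at ht
        apply hball
        rw [mem_ball_iff_norm, add_sub_cancel_left]
        refine ((A t).le_of_opNorm_le (hA1 t ht) _).trans_lt ?_
        rwa [one_mul, ← mem_ball_iff_norm]
      have hder : ∀ t ∈ Set.uIcc (0 : ℝ) 1, HasDerivAt (fun t : ℝ => f (q₀ + A t (q - q₀)))
          (q.1 * fderiv ℂ f (q₀ + A t (q - q₀)) e) t := by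
        intro t ht
        have h1 : HasDerivAt (fun t : ℝ => q₀ + A t (q - q₀)) (q.1 • e) t := by
          have h2 : (fun t : ℝ => q₀ + A t (q - q₀)) =
              fun t : ℝ => (t : ℂ) • (q.1 • e) + (0, q.2) := by
            ext t <;> simp [A, e, hq₀1]
          rw [h2]
          simpa using ((Complex.ofRealCLM.hasDerivAt (x := t)).smul_const (q.1 • e)).add_const
            ((0 : ℂ), q.2)
        have h3 := ((hfU _ (hmem t ht)).differentiableAt.hasFDerivAt.restrictScalars ℝ)
          |>.comp_hasDerivAt t h1
        have h4 : fderiv ℂ f (q₀ + A t (q - q₀)) (q.1 • e) =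
            q.1 * fderiv ℂ f (q₀ + A t (q - q₀)) e := by rw [map_smul, smul_eq_mul]
        rw [← h4]
        exact h3
      have hint : IntervalIntegrable (fun t => q.1 * fderiv ℂ f (q₀ + A t (q - q₀)) e)
          MeasureTheory.volume 0 1 := by
        refine ContinuousOn.intervalIntegrable fun t ht => ?_
        have h1 : ContinuousAt (fderiv ℂ f) (q₀ + A t (q - q₀)) :=
          (hfU _ (hmem t ht)).fderiv.continuousAt
        have h2 : ContinuousAt (fun t => q₀ + A t (q - q₀)) t := by fun_prop
        have h3 : ContinuousAt (fun t => fderiv ℂ f (q₀ + A t (q - q₀))) t :=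
          ContinuousAt.comp (g := fderiv ℂ f) h1 h2
        exact (continuousAt_const.mul (h3.clm_apply continuousAt_const)).continuousWithinAt
      have hFTC := intervalIntegral.integral_eq_sub_of_hasDerivAt hder hint
      have hA1q : q₀ + A 1 (q - q₀) = q := by ext <;> simp [A]
      have hA0q : f (q₀ + A 0 (q - q₀)) = 0 := h0 _ (hmem 0 (by simp)) (by simp [A, hq₀1])
      rw [intervalIntegral.integral_const_mul, hA1q, hA0q, sub_zero] at hFTC
      exact hFTC.symm
  refine ⟨fun q => if q.1 = 0 then fderiv ℂ f q e else f q / q.1, ?_, ?_⟩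
  · refine (contDiffOn_omega_iff_analyticOn hU.uniqueDiffOn).2 (AnalyticOnNhd.analyticOn ?_)
    intro q₀ hq₀
    by_cases hq : q₀.1 = 0
    · obtain ⟨g, hg, hfg⟩ := hloc q₀ hq₀ hq
      refine hg.congr ?_
      filter_upwards [hfg.eventually_nhds, hg.eventually_analyticAt] with q hq1 hq2
      by_cases hq0 : q.1 = 0
      · have h1 : HasFDerivAt (fun q : ℂ × F => q.1 * g q) _ q :=
          hasFDerivAt_fst.mul hq2.differentiableAt.hasFDerivAt
        have h2 : fderiv ℂ f q = _ := (Filter.EventuallyEq.fderiv_eq hq1).trans h1.fderiv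
        simp [hq0, h2, e]
      · simp [hq0, Filter.Eventually.self_of_nhds hq1]
    · have h1 : ∀ᶠ q : ℂ × F in 𝓝 q₀, q.1 ≠ 0 := continuousAt_fst.eventually_ne hq
      refine (((hfU q₀ hq₀).div analyticAt_fst hq)).congr ?_
      filter_upwards [h1] with q hq1
      simp [hq1]
  · intro q hq
    by_cases hq0 : q.1 = 0
    · simp [hq0, h0 q hq hq0]
    · simp [hq0, mul_div_cancel₀]

end Division

/-! ### The logarithmic tangent algebroid and the logarithmic form -/

section LogTangent

theorem logAnchor_apply (x v : ℂ × ℂ) : logAnchor x v = (x.1 * v.1, x.2 * v.2) := rfl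

theorem ContDiffAt.logAnchor {σ : ℂ × ℂ → ℂ × ℂ} {x : ℂ × ℂ} (hσ : ContDiffAt ℂ ω σ x) :
    ContDiffAt ℂ ω (fun y => logAnchor y (σ y)) x := by
  simp only [logAnchor_apply]
  fun_prop

variable {V : Type*} [NormedAddCommGroup V] [NormedSpace ℂ V]

/-- The derivative of a vector-valued function along the vector field `u x ∂_x + v y ∂_y` with
coefficients `σ = (u, v)`. -/
def logDerivation (σ : ℂ × ℂ → ℂ × ℂ) (f : ℂ × ℂ → V) (x : ℂ × ℂ) : V :=
  fderiv ℂ f x (logAnchor x (σ x))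

theorem ContDiffAt.logDerivation {σ : ℂ × ℂ → ℂ × ℂ} {f : ℂ × ℂ → V} {x : ℂ × ℂ}
    (hσ : ContDiffAt ℂ ω σ x) (hf : ContDiffAt ℂ ω f x) : ContDiffAt ℂ ω (logDerivation σ f) x :=
  (hf.fderiv_right (m := ω) le_rfl).clm_apply hσ.logAnchor

theorem Filter.EventuallyEq.logDerivation_eq {σ τ : ℂ × ℂ → ℂ × ℂ} {f g : ℂ × ℂ → V} {x : ℂ × ℂ}
    (hσ : σ x = τ x) (hf : f =ᶠ[𝓝 x] g) : logDerivation σ f x = logDerivation τ g x := by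
  rw [logDerivation, logDerivation, hσ, hf.fderiv_eq]

theorem logDerivation_add {σ : ℂ × ℂ → ℂ × ℂ} {f g : ℂ × ℂ → V} {x : ℂ × ℂ}
    (hf : ContDiffAt ℂ ω f x) (hg : ContDiffAt ℂ ω g x) :
    logDerivation σ (fun y => f y + g y) x = logDerivation σ f x + logDerivation σ g x := by
  simp [logDerivation, fderiv_fun_add (hf.differentiableAt (by simp))
    (hg.differentiableAt (by simp))]

theorem logDerivation_sub {σ : ℂ × ℂ → ℂ × ℂ} {f g : ℂ × ℂ → V} {x : ℂ × ℂ}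
    (hf : ContDiffAt ℂ ω f x) (hg : ContDiffAt ℂ ω g x) :
    logDerivation σ (fun y => f y - g y) x = logDerivation σ f x - logDerivation σ g x := by
  simp [logDerivation, fderiv_fun_sub (hf.differentiableAt (by simp))
    (hg.differentiableAt (by simp))]

theorem logDerivation_smul {σ : ℂ × ℂ → ℂ × ℂ} {f : ℂ × ℂ → ℂ} {g : ℂ × ℂ → V} {x : ℂ × ℂ}
    (hf : ContDiffAt ℂ ω f x) (hg : ContDiffAt ℂ ω g x) :
    logDerivation σ (fun y => f y • g y) x =
      f x • logDerivation σ g x + logDerivation σ f x • g x := by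
  simp [logDerivation, fderiv_fun_smul (hf.differentiableAt (by simp))
    (hg.differentiableAt (by simp))]

/-- The frame `x ∂_x`, `y ∂_y` commutes, so the Lie bracket of vector fields is computed by
differentiating their coefficients. -/
theorem lieBracket_logAnchor {σ τ : ℂ × ℂ → ℂ × ℂ} {x : ℂ × ℂ}
    (hσ : ContDiffAt ℂ ω σ x) (hτ : ContDiffAt ℂ ω τ x) :
    VectorField.lieBracket ℂ (fun y => logAnchor y (σ y)) (fun y => logAnchor y (τ y)) x =
      logAnchor x (logDerivation σ τ x - logDerivation τ σ x) := by
  have key : ∀ ρ : ℂ × ℂ → ℂ × ℂ, ContDiffAt ℂ ω ρ x → ∀ v : ℂ × ℂ,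
      fderiv ℂ (fun y => logAnchor y (ρ y)) x v =
        (v.1 * (ρ x).1 + x.1 * (fderiv ℂ ρ x v).1, v.2 * (ρ x).2 + x.2 * (fderiv ℂ ρ x v).2) := by
    intro ρ hρ v
    have hd := (hρ.differentiableAt (by simp)).hasFDerivAt
    have h : HasFDerivAt (fun y => logAnchor y (ρ y)) _ x :=
      ((hasFDerivAt_fst (p := x)).mul hd.fst).prodMk ((hasFDerivAt_snd (p := x)).mul hd.snd)
    rw [h.fderiv]
    simp
    constructor <;> ring
  rw [VectorField.lieBracket, key τ hτ, key σ hσ]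
  simp only [logAnchor_apply, logDerivation]
  ext <;> simp <;> ring

/-- The anchor of `T(-log D)` takes brackets to commutators of derivations. -/
theorem logDerivation_bracket {σ τ : ℂ × ℂ → ℂ × ℂ} {f : ℂ × ℂ → V} {x : ℂ × ℂ}
    (hσ : ContDiffAt ℂ ω σ x) (hτ : ContDiffAt ℂ ω τ x) (hf : ContDiffAt ℂ ω f x) :
    logDerivation (fun y => logDerivation σ τ y - logDerivation τ σ y) f x =
      logDerivation σ (logDerivation τ f) x - logDerivation τ (logDerivation σ f) x := by
  have h := VectorField.fderiv_apply_lieBracket (𝕜 := ℂ) (f := f) (x := x) hf (by simp)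
    (hτ.logAnchor.differentiableAt (by simp)) (hσ.logAnchor.differentiableAt (by simp))
  rw [lieBracket_logAnchor hσ hτ] at h
  exact h

theorem contDiffAt_of_isOpen {E F : Type*} [NormedAddCommGroup E] [NormedSpace ℂ E]
    [NormedAddCommGroup F] [NormedSpace ℂ F] {f : E → F} {U : Set E} (hU : IsOpen U)
    (hf : ContDiffOn ℂ ω f U) {x : E} (hx : x ∈ U) : ContDiffAt ℂ ω f x :=
  hf.contDiffAt (hU.mem_nhds hx)

theorem contDiffAt_of_isHol {σ : ℂ × ℂ → ℂ × ℂ} {U : Set (ℂ × ℂ)} (hU : IsOpen U)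
    (hσ : logTangent.IsHol U σ) {x : ℂ × ℂ} (hx : x ∈ U) : ContDiffAt ℂ ω σ x :=
  contDiffAt_of_isOpen hU hσ hx

theorem isHol_of_contDiffAt {σ : ℂ × ℂ → ℂ × ℂ} {U : Set (ℂ × ℂ)}
    (hσ : ∀ x ∈ U, ContDiffAt ℂ ω σ x) : logTangent.IsHol U σ :=
  fun x hx => (hσ x hx).contDiffWithinAt

theorem logTangent_deriv_apply (σ : ∀ x, logTangent.Fib x) (f : ℂ × ℂ → ℂ) (x : ℂ × ℂ) :
    logTangent.deriv σ f x = logDerivation σ f x :=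
  congrArg (fun L : ℂ × ℂ →L[ℂ] ℂ => L (logAnchor x (σ x))) mfderiv_eq_fderiv

/-- The coefficients of a vector in the frame `x ∂_x`, `y ∂_y` of `T(-log D)`. -/
def logFrame : Fin 2 → ℂ × ℂ := ![(1, 0), (0, 1)]

theorem sum_smul_logFrame (c : Fin 2 → ℂ) : ∑ i, c i • logFrame i = (c 0, c 1) := by
  ext <;> simp [logFrame, Fin.sum_univ_two]

theorem linearIndependent_logFrame : LinearIndependent ℂ logFrame := by
  rw [Fintype.linearIndependent_iff]
  intro g hg i
  rw [sum_smul_logFrame, Prod.mk_eq_zero] at hg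
  fin_cases i
  exacts [hg.1, hg.2]

theorem span_range_logFrame : Submodule.span ℂ (Set.range logFrame) = ⊤ := by
  rw [eq_top_iff]
  rintro v -
  rw [Submodule.mem_span_range_iff_exists_fun]
  exact ⟨![v.1, v.2], sum_smul_logFrame _⟩

theorem logTangent_isHol_iff {V : Set (ℂ × ℂ)} {σ : ℂ × ℂ → ℂ × ℂ} :
    logTangent.IsHol V σ ↔ ∃ c : Fin 2 → ℂ × ℂ → ℂ,
      (∀ i, ContMDiffOn 𝓘(ℂ, ℂ × ℂ) 𝓘(ℂ, ℂ) ω (c i) V) ∧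
        ∀ x ∈ V, σ x = ∑ i, c i x • logFrame i := by
  simp only [sum_smul_logFrame, contMDiffOn_iff_contDiffOn]
  refine ⟨fun h => ?_, fun ⟨c, hc, hσ⟩ => ContDiffOn.congr ((hc 0).prodMk (hc 1)) hσ⟩
  have h' : ContDiffOn ℂ ω σ V := h
  refine ⟨![fun x => (σ x).1, fun x => (σ x).2], fun i => ?_, fun x _ => rfl⟩
  fin_cases i
  exacts [h'.fst, h'.snd]

/-- The Jacobi identity for the bracket `σ(τ) - τ(σ)` of coefficients. -/
theorem logDerivation_bracket_jacobi {σ τ υ : ℂ × ℂ → ℂ × ℂ} {x : ℂ × ℂ}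
    (h1 : ContDiffAt ℂ ω σ x) (h2 : ContDiffAt ℂ ω τ x) (h3 : ContDiffAt ℂ ω υ x) :
    logDerivation σ (fun y => logDerivation τ υ y - logDerivation υ τ y) x
        - logDerivation (fun y => logDerivation τ υ y - logDerivation υ τ y) σ x =
      (logDerivation (fun y => logDerivation σ τ y - logDerivation τ σ y) υ x
        - logDerivation υ (fun y => logDerivation σ τ y - logDerivation τ σ y) x)
      + (logDerivation τ (fun y => logDerivation σ υ y - logDerivation υ σ y) x
        - logDerivation (fun y => logDerivation σ υ y - logDerivation υ σ y) τ x) := by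
  rw [logDerivation_sub (h2.logDerivation h3) (h3.logDerivation h2),
    logDerivation_sub (h1.logDerivation h2) (h2.logDerivation h1),
    logDerivation_sub (h1.logDerivation h3) (h3.logDerivation h1), logDerivation_bracket h2 h3 h1,
    logDerivation_bracket h1 h2 h3, logDerivation_bracket h1 h3 h2]
  abel

theorem logTangent_bracket_leibniz {f : ℂ × ℂ → ℂ} {σ τ : ℂ × ℂ → ℂ × ℂ} {x : ℂ × ℂ}
    (hf : ContDiffAt ℂ ω f x) (hτ : ContDiffAt ℂ ω τ x) :
    logDerivation σ (fun y => f y • τ y) x - logDerivation (fun y => f y • τ y) σ x =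
      f x • (logDerivation σ τ x - logDerivation τ σ x) + logDerivation σ f x • τ x := by
  have e2 : logDerivation (fun y => f y • τ y) σ x = f x • logDerivation τ σ x := by
    simp only [logDerivation, map_smul]
  rw [logDerivation_smul hf hτ, e2, smul_sub]
  abel

theorem logTangent_bracket_add {σ τ υ : ℂ × ℂ → ℂ × ℂ} {x : ℂ × ℂ}
    (hτ : ContDiffAt ℂ ω τ x) (hυ : ContDiffAt ℂ ω υ x) :
    logDerivation σ (fun y => τ y + υ y) x - logDerivation (fun y => τ y + υ y) σ x =
      (logDerivation σ τ x - logDerivation τ σ x) +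
        (logDerivation σ υ x - logDerivation υ σ x) := by
  have e2 : logDerivation (fun y => τ y + υ y) σ x =
      logDerivation τ σ x + logDerivation υ σ x := by
    simp only [logDerivation, map_add]
  rw [logDerivation_add hτ hυ, e2, add_sub_add_comm]

theorem isLieAlgebroid_logTangent : logTangent.IsLieAlgebroid where
  isHol_congr U σ τ h hσ := ContDiffOn.congr hσ fun x hx => (h x hx).symm
  isHol_mono U V σ _ _ hVU hσ := ContDiffOn.mono hσ hVU
  isHol_of_local U σ hU h := by
    intro x hx
    obtain ⟨V, hV, hxV, -, hσ⟩ := h x hx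
    exact (contDiffAt_of_isOpen hV hσ hxV).contDiffWithinAt
  exists_frame x₀ := ⟨Set.univ, 2, fun i _ => logFrame i, isOpen_univ, Set.mem_univ _,
    fun _ _ => ⟨linearIndependent_logFrame, span_range_logFrame⟩,
    fun _ _ _ _ => logTangent_isHol_iff⟩
  anchor_hol U σ hU hσ :=
    contMDiffOn_vectorSpace_iff_contDiffOn.2 fun x hx =>
      (contDiffAt_of_isHol hU hσ hx).logAnchor.contDiffWithinAt
  bracket_hol U σ τ hU hσ hτ := isHol_of_contDiffAt fun x hx =>
    have h1 := contDiffAt_of_isHol hU hσ hx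
    have h2 := contDiffAt_of_isHol hU hτ hx
    (h1.logDerivation h2).sub (h2.logDerivation h1)
  bracket_congr U σ σ' τ τ' hU _ _ h1 h2 x hx :=
    congrArg₂ (fun a b : ℂ × ℂ => a - b)
      (Filter.EventuallyEq.logDerivation_eq (h1 x hx)
        (Filter.eventuallyEq_of_mem (hU.mem_nhds hx) h2))
      (Filter.EventuallyEq.logDerivation_eq (h2 x hx)
        (Filter.eventuallyEq_of_mem (hU.mem_nhds hx) h1))
  bracket_antisymm U σ τ _ _ _ x _ :=
    (neg_sub (logDerivation τ σ x) (logDerivation σ τ x)).symm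
  bracket_add U σ τ υ hU _ hτ hυ x hx :=
    logTangent_bracket_add (contDiffAt_of_isHol hU hτ hx) (contDiffAt_of_isHol hU hυ hx)
  leibniz U f σ τ hU hf hσ hτ x hx := by
    rw [logTangent_deriv_apply]
    exact logTangent_bracket_leibniz (contDiffAt_of_isOpen hU hf.contDiffOn hx)
      (contDiffAt_of_isHol hU hτ hx)
  jacobi U σ τ υ hU hσ hτ hυ x hx :=
    logDerivation_bracket_jacobi (contDiffAt_of_isHol hU hσ hx)
      (contDiffAt_of_isHol hU hτ hx) (contDiffAt_of_isHol hU hυ hx)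

/-- A differentiable function annihilated by a nonzero linear form `L` vanishes, also at the zeros
of `L`: differentiate `L * h` there. -/
theorem eq_zero_of_clm_mul_eq_zero {L : ℂ × ℂ →L[ℂ] ℂ} {e : ℂ × ℂ} (he : L e = 1)
    {h : ℂ × ℂ → ℂ} {x : ℂ × ℂ} (hh : DifferentiableAt ℂ h x)
    (h0 : ∀ᶠ q in 𝓝 x, L q * h q = 0) : h x = 0 := by
  by_cases hx : L x = 0
  · have h1 : HasFDerivAt (fun q => L q * h q) _ x := L.hasFDerivAt.mul hh.hasFDerivAt
    have h2 : fderiv ℂ (fun q => L q * h q) x = 0 := by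
      rw [Filter.EventuallyEq.fderiv_eq (f := fun _ => (0 : ℂ)) h0]; simp
    have h3 := congrArg (fun l : ℂ × ℂ →L[ℂ] ℂ => l e) (h1.fderiv.symm.trans h2)
    simpa [hx, he] using h3
  · exact (mul_eq_zero.1 h0.self_of_nhds).resolve_left hx

theorem isTangentToDivisor_iff {U : Set (ℂ × ℂ)} {X : ℂ × ℂ → ℂ × ℂ} :
    IsTangentToDivisor U X ↔
      ∀ q ∈ U, q.1 * q.2 = 0 → q.1 * (X q).2 + q.2 * (X q).1 = 0 := by
  refine forall₂_congr fun q _ => ?_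
  have h : HasFDerivAt (fun r : ℂ × ℂ => r.1 * r.2) _ q :=
    (hasFDerivAt_fst (𝕜 := ℂ) (p := q)).mul (hasFDerivAt_snd (𝕜 := ℂ) (p := q))
  rw [h.fderiv]
  simp

/-- The first component of a vector field tangent to `xy = 0` vanishes on `x = 0`, by continuity
also at the origin, where tangency is no condition. -/
theorem IsTangentToDivisor.fst_eq_zero {U : Set (ℂ × ℂ)} (hU : IsOpen U) {X : ℂ × ℂ → ℂ × ℂ}
    (hX : ContDiffOn ℂ ω X U) (ht : IsTangentToDivisor U X) {q : ℂ × ℂ} (hq : q ∈ U)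
    (hq1 : q.1 = 0) : (X q).1 = 0 := by
  rw [isTangentToDivisor_iff] at ht
  have hq' : ((0 : ℂ), q.2) = q := by ext <;> simp [hq1]
  have hXq : DifferentiableAt ℂ X ((0 : ℂ), q.2) := by
    rw [hq']; exact (contDiffAt_of_isOpen hU hX hq).differentiableAt (by simp)
  have hφ : DifferentiableAt ℂ (fun r : ℂ × ℂ => ((0 : ℂ), r.2)) q := by fun_prop
  have hd : DifferentiableAt ℂ (fun r : ℂ × ℂ => (X (0, r.2)).1) q :=
    (DifferentiableAt.comp (g := X) q hXq hφ).fst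
  have hmem : ∀ᶠ r : ℂ × ℂ in 𝓝 q, ((0 : ℂ), r.2) ∈ U := by
    refine hφ.continuousAt.eventually_mem ?_
    rw [hq']
    exact hU.mem_nhds hq
  have := eq_zero_of_clm_mul_eq_zero (L := ContinuousLinearMap.snd ℂ ℂ ℂ) (e := (0, 1)) rfl hd
    (by
      filter_upwards [hmem] with r hr
      simpa using ht _ hr (by simp))
  rwa [hq'] at this

theorem isTangentToDivisor_swap {U : Set (ℂ × ℂ)} {X : ℂ × ℂ → ℂ × ℂ}
    (ht : IsTangentToDivisor U X) :
    IsTangentToDivisor (Prod.swap ⁻¹' U) fun q => (X q.swap).swap := by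
  rw [isTangentToDivisor_iff] at ht ⊢
  intro q hq h0
  have := ht q.swap hq (by simpa [mul_comm] using h0)
  simpa [add_comm] using this

/-- `T(-log D)` is free on `x ∂_x` and `y ∂_y`: the components of a vector field tangent to `D` are
divisible by `x` and by `y`. -/
theorem isLogTangentAlgebroid_logTangent : IsLogTangentAlgebroid logTangent where
  isLieAlgebroid := isLieAlgebroid_logTangent
  anchor_tangent U σ hU hσ := by
    refine ⟨fun x hx => (contDiffAt_of_isHol hU hσ hx).logAnchor.contDiffWithinAt, ?_⟩
    refine isTangentToDivisor_iff.2 fun q _ h0 => ?_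
    change q.1 * (q.2 * (σ q : ℂ × ℂ).2) + q.2 * (q.1 * (σ q : ℂ × ℂ).1) = 0
    linear_combination ((σ q : ℂ × ℂ).2 + (σ q : ℂ × ℂ).1) * h0
  anchor_injective U σ τ hU hσ hτ h x hx := by
    have hd : DifferentiableAt ℂ (fun y => (σ y - τ y : ℂ × ℂ)) x :=
      ((contDiffAt_of_isHol hU hσ hx).sub (contDiffAt_of_isHol hU hτ hx)).differentiableAt
        (by simp)
    have h' : ∀ᶠ q : ℂ × ℂ in 𝓝 x, (q.1 * (σ q : ℂ × ℂ).1, q.2 * (σ q : ℂ × ℂ).2) =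
        (q.1 * (τ q : ℂ × ℂ).1, q.2 * (τ q : ℂ × ℂ).2) :=
      Filter.eventually_of_mem (hU.mem_nhds hx) h
    have h1 := eq_zero_of_clm_mul_eq_zero (L := ContinuousLinearMap.fst ℂ ℂ ℂ) (e := (1, 0)) rfl
      hd.fst (h'.mono fun q hq => (mul_sub _ _ _).trans (sub_eq_zero.2 (congrArg Prod.fst hq)))
    have h2 := eq_zero_of_clm_mul_eq_zero (L := ContinuousLinearMap.snd ℂ ℂ ℂ) (e := (0, 1)) rfl
      hd.snd (h'.mono fun q hq => (mul_sub _ _ _).trans (sub_eq_zero.2 (congrArg Prod.snd hq)))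
    exact Prod.ext (sub_eq_zero.1 h1) (sub_eq_zero.1 h2)
  anchor_surjective U X hU hX ht := by
    have hsw : ContDiff ℂ ω (Prod.swap : ℂ × ℂ → ℂ × ℂ) := contDiff_snd.prodMk contDiff_fst
    have hU' : IsOpen (Prod.swap ⁻¹' U : Set (ℂ × ℂ)) := hU.preimage continuous_swap
    have hX' : ContDiffOn ℂ ω (fun q => (X q.swap).swap) (Prod.swap ⁻¹' U) :=
      hsw.comp_contDiffOn (hX.comp hsw.contDiffOn fun _ h => h)
    obtain ⟨u, hu, hXu⟩ := exists_contDiffOn_eq_fst_mul hU hX.fst fun q hq h1 =>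
      ht.fst_eq_zero hU hX hq h1
    obtain ⟨v, hv, hXv⟩ := exists_contDiffOn_eq_fst_mul hU' hX'.fst fun q hq h1 =>
      (isTangentToDivisor_swap ht).fst_eq_zero hU' hX' hq h1
    refine ⟨fun q => (u q, v q.swap), ?_, fun q hq => ?_⟩
    · exact hu.prodMk (hv.comp hsw.contDiffOn fun q hq => by simpa using hq)
    · have h2 := hXv q.swap (by simpa using hq)
      change (q.1 * u q, q.2 * v q.swap) = X q
      rw [← hXu q hq]
      simp only [Prod.swap_swap, Prod.fst_swap] at h2
      rw [← h2]
  anchor_bracket U σ τ hU hσ hτ x hx :=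
    (lieBracket_logAnchor (contDiffAt_of_isHol hU hσ hx) (contDiffAt_of_isHol hU hτ hx)).symm

theorem frameForm_apply (v w : ℂ × ℂ) : frameForm v w = v.1 * w.2 - v.2 * w.1 := rfl

theorem ContDiffAt.frameForm {σ τ : ℂ × ℂ → ℂ × ℂ} {x : ℂ × ℂ} (hσ : ContDiffAt ℂ ω σ x)
    (hτ : ContDiffAt ℂ ω τ x) : ContDiffAt ℂ ω (fun y => frameForm (σ y) (τ y)) x := by
  simp only [frameForm_apply]
  fun_prop

theorem logDerivation_frameForm {ρ σ τ : ℂ × ℂ → ℂ × ℂ} {x : ℂ × ℂ} (hσ : ContDiffAt ℂ ω σ x)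
    (hτ : ContDiffAt ℂ ω τ x) :
    logDerivation ρ (fun y => frameForm (σ y) (τ y)) x =
      frameForm (logDerivation ρ σ x) (τ x) + frameForm (σ x) (logDerivation ρ τ x) := by
  have h1 := (hσ.differentiableAt (by simp)).hasFDerivAt
  have h2 := (hτ.differentiableAt (by simp)).hasFDerivAt
  have h : HasFDerivAt (fun y => frameForm (σ y) (τ y)) _ x :=
    (h1.fst.mul h2.snd).sub (h1.snd.mul h2.fst)
  rw [logDerivation, h.fderiv]
  simp [frameForm_apply, logDerivation]
  ring

/-- `dx ∧ dy / (xy)` is closed, in terms of coefficients. -/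
theorem logDerivation_frameForm_cyclic {σ τ υ : ℂ × ℂ → ℂ × ℂ} {x : ℂ × ℂ}
    (h1 : ContDiffAt ℂ ω σ x) (h2 : ContDiffAt ℂ ω τ x) (h3 : ContDiffAt ℂ ω υ x) :
    logDerivation σ (fun y => frameForm (τ y) (υ y)) x
      - logDerivation τ (fun y => frameForm (σ y) (υ y)) x
      + logDerivation υ (fun y => frameForm (σ y) (τ y)) x
      - frameForm (logDerivation σ τ x - logDerivation τ σ x) (υ x)
      + frameForm (logDerivation σ υ x - logDerivation υ σ x) (τ x)
      - frameForm (logDerivation τ υ x - logDerivation υ τ x) (σ x) = 0 := by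
  rw [logDerivation_frameForm h2 h3, logDerivation_frameForm h1 h3, logDerivation_frameForm h1 h2]
  simp only [frameForm_apply, Prod.fst_sub, Prod.snd_sub]
  ring

theorem isClosedTwoForm_logForm : logTangent.IsClosedTwoForm logForm where
  alternating x v := by
    change v.1 * v.2 - v.2 * v.1 = 0
    ring
  hol U σ τ hU hσ hτ := by
    rw [contMDiffOn_iff_contDiffOn]
    exact fun x hx => ((contDiffAt_of_isHol hU hσ hx).frameForm
      (contDiffAt_of_isHol hU hτ hx)).contDiffWithinAt
  closed U σ τ υ hU hσ hτ hυ x hx := by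
    have h1 := contDiffAt_of_isHol hU hσ hx
    have h2 := contDiffAt_of_isHol hU hτ hx
    have h3 := contDiffAt_of_isHol hU hυ hx
    rw [logTangent_deriv_apply, logTangent_deriv_apply, logTangent_deriv_apply]
    exact logDerivation_frameForm_cyclic h1 h2 h3

end LogTangent

/-! ### Extensions of Lie algebroids by closed `2`-forms -/

section Twist

namespace LieAlgebroidData

variable {E : Type} [NormedAddCommGroup E] [NormedSpace ℂ E]
  {A : LieAlgebroidData 𝓘(ℂ, E) E} {w : ∀ x, A.Fib x →ₗ[ℂ] A.Fib x →ₗ[ℂ] ℂ}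

theorem deriv_apply (σ : ∀ x, A.Fib x) (f : E → ℂ) (x : E) :
    A.deriv σ f x = fderiv ℂ f x (A.anchor x (σ x) : E) :=
  congrArg (fun L : E →L[ℂ] ℂ => L (A.anchor x (σ x))) mfderiv_eq_fderiv

theorem IsLieAlgebroid.contDiffOn_anchor (hA : A.IsLieAlgebroid) {U : Set E} (hU : IsOpen U)
    {σ : ∀ x, A.Fib x} (hσ : A.IsHol U σ) :
    ContDiffOn ℂ ω (fun x => (A.anchor x (σ x) : E)) U :=
  contMDiffOn_vectorSpace_iff_contDiffOn.1 (hA.anchor_hol U σ hU hσ)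

theorem IsLieAlgebroid.contDiffOn_deriv (hA : A.IsLieAlgebroid) {U : Set E} (hU : IsOpen U)
    {σ : ∀ x, A.Fib x} (hσ : A.IsHol U σ) {f : E → ℂ} (hf : ContDiffOn ℂ ω f U) :
    ContDiffOn ℂ ω (A.deriv σ f) U := by
  rw [funext (deriv_apply σ f)]
  exact (hf.fderiv_of_isOpen (m := ω) hU le_rfl).clm_apply (hA.contDiffOn_anchor hU hσ)

theorem deriv_add {σ : ∀ x, A.Fib x} {f g : E → ℂ} {x : E}
    (hf : ContDiffAt ℂ ω f x) (hg : ContDiffAt ℂ ω g x) :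
    A.deriv σ (fun y => f y + g y) x = A.deriv σ f x + A.deriv σ g x := by
  simp only [deriv_apply]
  rw [fderiv_fun_add (hf.differentiableAt (by simp))
    (hg.differentiableAt (by simp))]
  rfl

theorem deriv_sub {σ : ∀ x, A.Fib x} {f g : E → ℂ} {x : E}
    (hf : ContDiffAt ℂ ω f x) (hg : ContDiffAt ℂ ω g x) :
    A.deriv σ (fun y => f y - g y) x = A.deriv σ f x - A.deriv σ g x := by
  simp only [deriv_apply]
  rw [fderiv_fun_sub (hf.differentiableAt (by simp))
    (hg.differentiableAt (by simp))]
  rfl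

theorem deriv_mul {σ : ∀ x, A.Fib x} {f g : E → ℂ} {x : E}
    (hf : ContDiffAt ℂ ω f x) (hg : ContDiffAt ℂ ω g x) :
    A.deriv σ (fun y => f y * g y) x = f x * A.deriv σ g x + A.deriv σ f x * g x := by
  simp only [deriv_apply]
  rw [fderiv_fun_mul (hf.differentiableAt (by simp))
    (hg.differentiableAt (by simp))]
  change f x * fderiv ℂ g x (A.anchor x (σ x) : E) + g x * fderiv ℂ f x (A.anchor x (σ x) : E) = _
  ring

theorem deriv_section_add {σ τ : ∀ x, A.Fib x} {f : E → ℂ} {x : E} :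
    A.deriv (fun y => σ y + τ y) f x = A.deriv σ f x + A.deriv τ f x := by
  simp only [deriv_apply, map_add]
  exact map_add (fderiv ℂ f x) _ _

theorem deriv_section_smul {σ : ∀ x, A.Fib x} {f g : E → ℂ} {x : E} :
    A.deriv (fun y => g y • σ y) f x = g x * A.deriv σ f x := by
  simp only [deriv_apply, map_smul]
  exact map_smul (fderiv ℂ f x) _ _

theorem deriv_congr {σ τ : ∀ x, A.Fib x} {f g : E → ℂ} {U : Set E} (hU : IsOpen U) {x : E}
    (hx : x ∈ U) (h : ∀ y ∈ U, σ y = τ y) (hfg : ∀ y ∈ U, f y = g y) :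
    A.deriv σ f x = A.deriv τ g x := by
  rw [deriv_apply, deriv_apply, h x hx,
    (Filter.eventuallyEq_of_mem (hU.mem_nhds hx) hfg).fderiv_eq]

/-- When the anchor is a morphism of brackets, sections act on functions by a representation. -/
theorem IsLieAlgebroid.deriv_bracket (hA : A.IsLieAlgebroid)
    (hanchor : ∀ (U : Set E) (σ τ : ∀ x, A.Fib x), IsOpen U → A.IsHol U σ → A.IsHol U τ →
      ∀ x ∈ U, A.anchor x (A.bracket σ τ x) =
        VectorField.lieBracket ℂ (fun y => (A.anchor y (σ y) : E))
          (fun y => (A.anchor y (τ y) : E)) x)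
    {U : Set E} (hU : IsOpen U) {σ τ : ∀ x, A.Fib x} (hσ : A.IsHol U σ) (hτ : A.IsHol U τ)
    {f : E → ℂ} (hf : ContDiffOn ℂ ω f U) {x : E} (hx : x ∈ U) :
    A.deriv (A.bracket σ τ) f x =
      A.deriv σ (A.deriv τ f) x - A.deriv τ (A.deriv σ f) x := by
  have h1 := (hA.contDiffOn_anchor hU hσ).contDiffAt (hU.mem_nhds hx)
  have h2 := (hA.contDiffOn_anchor hU hτ).contDiffAt (hU.mem_nhds hx)
  have h := VectorField.fderiv_apply_lieBracket (𝕜 := ℂ) (f := f) (x := x)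
    (hf.contDiffAt (hU.mem_nhds hx)) (by simp)
    (h2.differentiableAt (by simp)) (h1.differentiableAt (by simp))
  rw [deriv_apply, hanchor U σ τ hU hσ hτ x hx, deriv_apply, deriv_apply,
    funext (deriv_apply σ f), funext (deriv_apply τ f)]
  exact h

theorem IsClosedTwoForm.antisymm (hw : A.IsClosedTwoForm w) (x : E) (u v : A.Fib x) :
    w x u v = -w x v u := by
  have h := hw.alternating x (u + v)
  simp only [map_add, LinearMap.add_apply, hw.alternating, zero_add, add_zero] at h
  exact eq_neg_of_add_eq_zero_right h

/-- A frame of `A ⊕ ℂ_M` from a frame of `A`: its first member spans `ℂ_M`. -/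
def twistFrame {r : ℕ} (e : Fin r → ∀ x, A.Fib x) : Fin (r + 1) → ∀ x, (A.twist w).Fib x :=
  Fin.cons (fun x => ((0 : A.Fib x), (1 : ℂ))) fun i x => (e i x, (0 : ℂ))

theorem sum_smul_twistFrame {r : ℕ} (e : Fin r → ∀ x, A.Fib x) (c : Fin (r + 1) → ℂ) (x : E) :
    ∑ i, c i • twistFrame (w := w) e i x = (∑ i : Fin r, c i.succ • e i x, c 0) := by
  rw [Fin.sum_univ_succ]
  change (c 0 • ((0 : A.Fib x), (1 : ℂ)) + ∑ i : Fin r, c i.succ • (e i x, (0 : ℂ)) :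
    A.Fib x × ℂ) = _
  refine Prod.ext ?_ ?_
  · simp [Prod.fst_sum]
  · simp [Prod.snd_sum]

/-- The bracket of `A ⊕ ℂ_M` defined by a closed `2`-form satisfies the axioms; its Jacobi identity
is the closedness of the form together with the Jacobi identity of `A`. -/
theorem IsLieAlgebroid.twist (hA : A.IsLieAlgebroid)
    (hanchor : ∀ (U : Set E) (σ τ : ∀ x, A.Fib x), IsOpen U → A.IsHol U σ → A.IsHol U τ →
      ∀ x ∈ U, A.anchor x (A.bracket σ τ x) =
        VectorField.lieBracket ℂ (fun y => (A.anchor y (σ y) : E))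
          (fun y => (A.anchor y (τ y) : E)) x)
    (hw : A.IsClosedTwoForm w) : (A.twist w).IsLieAlgebroid where
  isHol_congr U σ τ h hσ :=
    ⟨hA.isHol_congr U _ _ (fun x hx => congrArg Prod.fst (h x hx)) hσ.1,
      hσ.2.congr fun x hx => congrArg Prod.snd (h x hx).symm⟩
  isHol_mono U V σ hU hV hVU hσ := ⟨hA.isHol_mono U V _ hU hV hVU hσ.1, hσ.2.mono hVU⟩
  isHol_of_local U σ hU h := by
    refine ⟨hA.isHol_of_local U _ hU fun x hx => ?_, fun x hx => ?_⟩
    · obtain ⟨V, hV, hxV, hVU, hσ⟩ := h x hx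
      exact ⟨V, hV, hxV, hVU, hσ.1⟩
    · obtain ⟨V, hV, hxV, -, hσ⟩ := h x hx
      exact (hσ.2.contMDiffAt (hV.mem_nhds hxV)).contMDiffWithinAt
  exists_frame x₀ := by
    obtain ⟨U, r, e, hU, hx₀, he, hhol⟩ := hA.exists_frame x₀
    refine ⟨U, r + 1, twistFrame e, hU, hx₀, fun x hx => ⟨?_, ?_⟩, fun V σ hV hVU => ?_⟩
    · rw [Fintype.linearIndependent_iff]
      intro c hc
      rw [sum_smul_twistFrame] at hc
      have h1 := Fintype.linearIndependent_iff.1 (he x hx).1 _ (congrArg Prod.fst hc)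
      intro i
      exact Fin.cases (congrArg Prod.snd hc) h1 i
    · rw [eq_top_iff]
      rintro v -
      obtain ⟨c, hc⟩ := (Submodule.mem_span_range_iff_exists_fun ℂ).1
        ((he x hx).2.symm ▸ Submodule.mem_top : v.1 ∈ Submodule.span ℂ (Set.range fun i => e i x))
      refine (Submodule.mem_span_range_iff_exists_fun ℂ).2 ⟨Fin.cons v.2 c, ?_⟩
      rw [sum_smul_twistFrame]
      exact Prod.ext (by simpa using hc) rfl
    · constructor
      · rintro ⟨h1, h2⟩
        obtain ⟨c, hc, hσ⟩ := (hhol V _ hV hVU).1 h1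
        refine ⟨Fin.cons (fun x => (σ x).2) c, fun i => Fin.cases h2 hc i, fun x hx => ?_⟩
        rw [sum_smul_twistFrame]
        exact Prod.ext (by simpa using hσ x hx) rfl
      · rintro ⟨c, hc, hσ⟩
        simp only [sum_smul_twistFrame] at hσ
        refine ⟨(hhol V _ hV hVU).2 ⟨fun i => c i.succ, fun i => hc i.succ, fun x hx =>
          congrArg Prod.fst (hσ x hx)⟩, (hc 0).congr fun x hx => congrArg Prod.snd (hσ x hx)⟩
  anchor_hol U σ hU hσ := hA.anchor_hol U _ hU hσ.1
  bracket_hol U σ τ hU hσ hτ := by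
    refine ⟨hA.bracket_hol U _ _ hU hσ.1 hτ.1, ContMDiffOn.add (ContMDiffOn.sub ?_ ?_) ?_⟩
    · exact (hA.contDiffOn_deriv hU hσ.1 hτ.2.contDiffOn).contMDiffOn
    · exact (hA.contDiffOn_deriv hU hτ.1 hσ.2.contDiffOn).contMDiffOn
    · exact hw.hol U _ _ hU hσ.1 hτ.1
  bracket_congr U σ σ' τ τ' hU hσ hτ h1 h2 x hx := by
    have h11 := fun y hy => congrArg Prod.fst (h1 y hy)
    have h12 := fun y hy => congrArg Prod.snd (h1 y hy)
    have h21 := fun y hy => congrArg Prod.fst (h2 y hy)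
    have h22 := fun y hy => congrArg Prod.snd (h2 y hy)
    refine Prod.ext (hA.bracket_congr U _ _ _ _ hU hσ.1 hτ.1 h11 h21 x hx) ?_
    exact congrArg₂ (· + ·) (congrArg₂ (· - ·) (deriv_congr hU hx h11 h22)
      (deriv_congr hU hx h21 h12)) (by rw [h1 x hx, h2 x hx])
  bracket_antisymm U σ τ hU hσ hτ x hx := by
    refine Prod.ext (hA.bracket_antisymm U _ _ hU hσ.1 hτ.1 x hx) ?_
    change _ - _ + w x (σ x).1 (τ x).1 = -(_ - _ + w x (τ x).1 (σ x).1)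
    rw [hw.antisymm x (σ x).1]
    ring
  bracket_add U σ τ υ hU hσ hτ hυ x hx := by
    refine Prod.ext (hA.bracket_add U _ _ _ hU hσ.1 hτ.1 hυ.1 x hx) ?_
    have e1 := deriv_add (σ := fun y => (σ y).1) (hτ.2.contDiffOn.contDiffAt (hU.mem_nhds hx))
      (hυ.2.contDiffOn.contDiffAt (hU.mem_nhds hx))
    have e2 := deriv_section_add (σ := fun y => (τ y).1) (τ := fun y => (υ y).1)
      (f := fun y => (σ y).2) (x := x)
    have e3 := map_add (w x (σ x).1) (τ x).1 (υ x).1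
    refine (congrArg₂ (· + ·) (congrArg₂ (· - ·) e1 e2) e3).trans ?_
    change _ = (_ - _ + w x (σ x).1 (τ x).1) + (_ - _ + w x (σ x).1 (υ x).1)
    ring
  leibniz U f σ τ hU hf hσ hτ x hx := by
    refine Prod.ext (hA.leibniz U f _ _ hU hf hσ.1 hτ.1 x hx) ?_
    have e1 := deriv_mul (σ := fun y => (σ y).1) (hf.contDiffOn.contDiffAt (hU.mem_nhds hx))
      (hτ.2.contDiffOn.contDiffAt (hU.mem_nhds hx))
    have e2 := deriv_section_smul (σ := fun y => (τ y).1) (f := fun y => (σ y).2) (g := f) (x := x)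
    have e3 := map_smul (w x (σ x).1) (f x) (τ x).1
    refine (congrArg₂ (· + ·) (congrArg₂ (· - ·) e1 e2) e3).trans ?_
    change f x * A.deriv (fun y => (σ y).1) (fun y => (τ y).2) x +
        A.deriv (fun y => (σ y).1) f x * (τ x).2 -
        f x * A.deriv (fun y => (τ y).1) (fun y => (σ y).2) x + f x * w x (σ x).1 (τ x).1 =
      f x * (A.deriv (fun y => (σ y).1) (fun y => (τ y).2) x -
        A.deriv (fun y => (τ y).1) (fun y => (σ y).2) x + w x (σ x).1 (τ x).1) +
        A.deriv (fun y => (σ y).1) f x * (τ x).2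
    ring
  jacobi U σ τ υ hU hσ hτ hυ x hx := by
    refine Prod.ext (hA.jacobi U _ _ _ hU hσ.1 hτ.1 hυ.1 x hx) ?_
    obtain ⟨hσ1, hσ2⟩ := hσ
    obtain ⟨hτ1, hτ2⟩ := hτ
    obtain ⟨hυ1, hυ2⟩ := hυ
    have key : ∀ α β γ : ∀ x, (A.twist w).Fib x,
        A.IsHol U (fun y => (α y).1) → A.IsHol U (fun y => (β y).1) → A.IsHol U (fun y => (γ y).1) →
        ContDiffOn ℂ ω (fun y => (β y).2) U → ContDiffOn ℂ ω (fun y => (γ y).2) U →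
        A.deriv (fun y => (α y).1) (fun y => ((A.twist w).bracket β γ y).2) x =
          A.deriv (fun y => (α y).1) (A.deriv (fun y => (β y).1) fun y => (γ y).2) x
          - A.deriv (fun y => (α y).1) (A.deriv (fun y => (γ y).1) fun y => (β y).2) x
          + A.deriv (fun y => (α y).1) (fun y => w y (β y).1 (γ y).1) x := by
      intro α β γ _ hβ hγ hβ2 hγ2
      have d1 := (hA.contDiffOn_deriv hU hβ hγ2).contDiffAt (hU.mem_nhds hx)
      have d2 := (hA.contDiffOn_deriv hU hγ hβ2).contDiffAt (hU.mem_nhds hx)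
      have d3 := (hw.hol U _ _ hU hβ hγ).contDiffOn.contDiffAt (hU.mem_nhds hx)
      have := deriv_add (σ := fun y => (α y).1) (d1.sub d2) d3
      rw [show A.deriv (fun y => (α y).1) (fun y => ((A.twist w).bracket β γ y).2) x = _ from this]
      congr 1
      exact deriv_sub d1 d2
    have k1 := key σ τ υ hσ1 hτ1 hυ1 hτ2.contDiffOn hυ2.contDiffOn
    have k2 := key υ σ τ hυ1 hσ1 hτ1 hσ2.contDiffOn hτ2.contDiffOn
    have k3 := key τ σ υ hτ1 hσ1 hυ1 hσ2.contDiffOn hυ2.contDiffOn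
    have b1 := hA.deriv_bracket hanchor hU hτ1 hυ1 hσ2.contDiffOn hx
    have b2 := hA.deriv_bracket hanchor hU hσ1 hτ1 hυ2.contDiffOn hx
    have b3 := hA.deriv_bracket hanchor hU hσ1 hυ1 hτ2.contDiffOn hx
    have hc := hw.closed U _ _ _ hU hσ1 hτ1 hυ1 x hx
    have a1 := hw.antisymm x (σ x).1 (A.bracket (fun y => (τ y).1) (fun y => (υ y).1) x)
    have a2 := hw.antisymm x (τ x).1 (A.bracket (fun y => (σ y).1) (fun y => (υ y).1) x)
    change A.deriv (fun y => (σ y).1) (fun y => ((A.twist w).bracket τ υ y).2) x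
        - A.deriv (A.bracket (fun y => (τ y).1) fun y => (υ y).1) (fun y => (σ y).2) x
        + w x (σ x).1 (A.bracket (fun y => (τ y).1) (fun y => (υ y).1) x) =
      (A.deriv (A.bracket (fun y => (σ y).1) fun y => (τ y).1) (fun y => (υ y).2) x
        - A.deriv (fun y => (υ y).1) (fun y => ((A.twist w).bracket σ τ y).2) x
        + w x (A.bracket (fun y => (σ y).1) (fun y => (τ y).1) x) (υ x).1)
      + (A.deriv (fun y => (τ y).1) (fun y => ((A.twist w).bracket σ υ y).2) x
        - A.deriv (A.bracket (fun y => (σ y).1) fun y => (υ y).1) (fun y => (τ y).2) x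
        + w x (τ x).1 (A.bracket (fun y => (σ y).1) (fun y => (υ y).1) x))
    rw [k1, k2, k3, b1, b2, b3, a1, a2]
    linear_combination hc

theorem IsLieAlgebroid.isHol_zero (hA : A.IsLieAlgebroid) {U : Set E} (hU : IsOpen U) :
    A.IsHol U fun _ => 0 := by
  refine hA.isHol_of_local U _ hU fun x hx => ?_
  obtain ⟨V, r, e, hV, hxV, -, hhol⟩ := hA.exists_frame x
  refine ⟨U ∩ V, hU.inter hV, ⟨hx, hxV⟩, Set.inter_subset_left, ?_⟩
  exact (hhol _ _ (hU.inter hV) Set.inter_subset_right).2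
    ⟨fun _ _ => 0, fun _ => contMDiffOn_const, fun y _ => by simp⟩

theorem IsLieAlgebroid.bracket_zero (hA : A.IsLieAlgebroid) {U : Set E} (hU : IsOpen U)
    {σ : ∀ x, A.Fib x} (hσ : A.IsHol U σ) {x : E} (hx : x ∈ U) :
    A.bracket σ (fun _ => 0) x = 0 := by
  have h := hA.bracket_add U σ _ _ hU hσ (hA.isHol_zero hU) (hA.isHol_zero hU) x hx
  simpa using h

theorem deriv_zero_section (f : E → ℂ) (x : E) : A.deriv (fun _ => 0) f x = 0 := by
  rw [deriv_apply, map_zero]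
  exact map_zero (fderiv ℂ f x)

/-- A closed `2`-form defines a central extension by `ℂ_M`. -/
theorem IsLieAlgebroid.isCentralExtension_twist (hA : A.IsLieAlgebroid)
    (hanchor : ∀ (U : Set E) (σ τ : ∀ x, A.Fib x), IsOpen U → A.IsHol U σ → A.IsHol U τ →
      ∀ x ∈ U, A.anchor x (A.bracket σ τ x) =
        VectorField.lieBracket ℂ (fun y => (A.anchor y (σ y) : E))
          (fun y => (A.anchor y (τ y) : E)) x)
    (hw : A.IsClosedTwoForm w) :
    IsCentralExtension (A.twist w) A (fun _ => LinearMap.inr ℂ _ ℂ)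
      (fun _ => LinearMap.fst ℂ _ ℂ) where
  isLieAlgebroid_total := hA.twist hanchor hw
  isLieAlgebroid_base := hA
  hol_incl U f hU hf := ⟨hA.isHol_zero hU, hf⟩
  hol_proj U σ _ hσ := hσ.1
  incl_injective x := LinearMap.inr_injective
  proj_surjective x := LinearMap.fst_surjective
  exact x := LinearMap.range_inr ℂ (A.Fib x) ℂ
  anchor_proj x v := rfl
  bracket_proj U σ τ _ _ _ x _ := rfl
  incl_abelian U f g hU _ _ x hx := by
    refine Prod.ext (hA.bracket_zero hU (hA.isHol_zero hU) hx) ?_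
    change A.deriv (fun _ => 0) g x - A.deriv (fun _ => 0) f x + w x 0 0 = 0
    rw [deriv_zero_section, deriv_zero_section, map_zero]
    ring
  central U f σ hU _ hσ x hx := by
    refine Prod.ext (hA.bracket_zero hU hσ.1 hx).symm ?_
    change A.deriv (fun y => (σ y).1) f x = A.deriv (fun y => (σ y).1) f x
      - A.deriv (fun _ => 0) (fun y => (σ y).2) x + w x (σ x).1 0
    rw [deriv_zero_section, map_zero]
    ring

end LieAlgebroidData

end Twist

/-! ### Action groupoids and their Lie algebroids -/

section ActionGroupoid

variable {V : Type} [NormedAddCommGroup V] [NormedSpace ℂ V]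
  {W : Type} [NormedAddCommGroup W] [NormedSpace ℂ W] [Group V]

/-- A group structure on a complex vector space `V`, unrelated to the addition of `V`, and its
action on a complex vector space `W` are holomorphic. -/
structure IsHolomorphicAction (act : V →* Equiv.Perm W) : Prop where
  contDiff_mul : ContDiff ℂ ω fun q : V × V => q.1 * q.2
  contDiff_inv : ContDiff ℂ ω fun g : V => g⁻¹
  contDiff_act : ContDiff ℂ ω fun q : V × W => act q.1 q.2

variable {act : V →* Equiv.Perm W}

/-- The biholomorphism `(g, x) ↦ (g, g • x)` of `V × W`. -/
def actShear (act : V →* Equiv.Perm W) : V × W ≃ V × W where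
  toFun q := (q.1, act q.1 q.2)
  invFun q := (q.1, act q.1⁻¹ q.2)
  left_inv q := by simp
  right_inv q := by simp

/-- Source and target are submersions: the source is a linear projection, and so is the target after
the biholomorphism `(g, x) ↦ (g, g • x)`. -/
theorem isLieGroupoid_action [FiniteDimensional ℂ V] [FiniteDimensional ℂ W]
    (h : IsHolomorphicAction act)
    {I : ModelWithCorners ℂ (V × W) (V × W)} {cG : ChartedSpace (V × W) (V × W)}
    (hI : I = 𝓘(ℂ, V × W)) (hcG : cG = chartedSpaceSelf (V × W)) :
    (GroupoidData.action act).IsLieGroupoid 𝓘(ℂ, W) I where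
  finiteDimensional_obj := inferInstance
  finiteDimensional_arr := inferInstance
  boundaryless_obj := inferInstance
  boundaryless_arr := by subst hI; infer_instance
  isManifold_obj := inferInstance
  isManifold_arr := by subst hI hcG; infer_instance
  src_one x := rfl
  tgt_one x := by simp [GroupoidData.action]
  src_mul g h _ := rfl
  tgt_mul g h hgh := by
    simp only [GroupoidData.action] at hgh ⊢
    rw [map_mul, Equiv.Perm.mul_apply, hgh]
  mul_assoc g h k _ _ := by simp [GroupoidData.action, mul_assoc]
  one_mul g := by simp [GroupoidData.action]
  mul_one g := by simp [GroupoidData.action]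
  src_inv g := rfl
  tgt_inv g := by simp [GroupoidData.action]
  inv_mul g := by simp [GroupoidData.action]
  mul_inv g := by simp [GroupoidData.action]
  src_submersion := isSubmersion_of_eq_self hI hcG rfl rfl (Equiv.refl _) contDiff_id contDiff_id
    (ContinuousLinearEquiv.prodComm ℂ V W) fun _ => rfl
  tgt_submersion := isSubmersion_of_eq_self hI hcG rfl rfl (actShear act)
    (contDiff_fst.prodMk h.contDiff_act)
    (contDiff_fst.prodMk (h.contDiff_act.comp ((h.contDiff_inv.comp contDiff_fst).prodMk
      contDiff_snd)))
    (ContinuousLinearEquiv.prodComm ℂ V W) fun _ => rfl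
  one_hol := (contMDiff_iff_contDiff_of_eq_self rfl rfl hI hcG).2
    (contDiff_const.prodMk contDiff_id)
  inv_hol := (contMDiff_iff_contDiff_of_eq_self hI hcG hI hcG).2
    ((h.contDiff_inv.comp contDiff_fst).prodMk h.contDiff_act)
  mul_hol := by
    subst hI hcG
    refine ContMDiff.contMDiffOn ((contMDiff_iff_contDiff_of_eq_self modelWithCornersSelf_prod.symm
      chartedSpaceSelf_prod rfl rfl).2 ?_)
    exact (h.contDiff_mul.comp ((contDiff_fst.comp contDiff_fst).prodMk
      (contDiff_fst.comp contDiff_snd))).prodMk (contDiff_snd.comp contDiff_snd)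

/-- The infinitesimal action: the value at `x` of the vector field on `W` generated by `k`. -/
def infinitesimalAction (act : V →* Equiv.Perm W) (x : W) (k : V) : W :=
  fderiv ℂ (fun q : V × W => act q.1 q.2) (1, x) (k, 0)

/-- The differential at the identity of right multiplication by `g`. -/
def rightDifferential (g : V) : V →L[ℂ] V :=
  fderiv ℂ (fun h : V => h * g) 1

theorem IsHolomorphicAction.contDiff_rightDifferential (h : IsHolomorphicAction act) :
    ContDiff ℂ ω (rightDifferential (V := V)) := by
  refine ContDiff.fderiv (f := fun g h : V => h * g) (n := ω) ?_ contDiff_const le_rfl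
  exact h.contDiff_mul.comp (contDiff_snd.prodMk contDiff_fst)

theorem rightDifferential_one : rightDifferential (1 : V) = ContinuousLinearMap.id ℂ V := by
  simp [rightDifferential]

theorem IsHolomorphicAction.hasFDerivAt_mul_right (h : IsHolomorphicAction act) (g : V) :
    HasFDerivAt (fun h : V => h * g) (rightDifferential g) 1 := by
  have : ContDiff ℂ ω fun h : V => h * g :=
    h.contDiff_mul.comp (contDiff_id.prodMk contDiff_const)
  exact (this.differentiable (by simp) 1).hasFDerivAt

section

variable {I : ModelWithCorners ℂ (V × W) (V × W)} {cG : ChartedSpace (V × W) (V × W)}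

/-- Right translation in the action groupoid acts on vectors tangent to the source fibres by right
translation in the group. -/
theorem rightTranslate_action (h : IsHolomorphicAction act)
    (hI : I = 𝓘(ℂ, V × W)) (hcG : cG = chartedSpaceSelf (V × W)) (g : V × W) (k : V) :
    ((GroupoidData.action act).rightTranslate I g ((k, 0) : V × W) : V × W) =
      (rightDifferential g.1 k, 0) := by
  subst hI hcG
  set S : Set (V × W) := Prod.snd ⁻¹' {act g.1 g.2} with hS
  let x : V × W := (1, act g.1 g.2)
  let f : V × W → V × W := fun h => (h.1 * g.1, g.2)
  change (mfderivWithin 𝓘(ℂ, V × W) 𝓘(ℂ, V × W) f S x : V × W →L[ℂ] V × W) (k, 0) = _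
  rw [mfderivWithin_eq_fderivWithin]
  have h1 : HasFDerivAt f _ x :=
    (HasFDerivAt.comp (g := fun h : V => h * g.1) x (h.hasFDerivAt_mul_right g.1)
      hasFDerivAt_fst).prodMk (hasFDerivAt_const g.2 x)
  have h2 := h1.hasFDerivWithinAt (s := S)
  -- the source fibre is not a set of unique differentiability, but its derivatives agree on
  -- vectors tangent to it
  have h3 := HasFDerivWithinAt.unique_on h2.differentiableWithinAt.hasFDerivWithinAt h2
  have hk : ((k, 0) : V × W) ∈ tangentConeAt ℂ S x := by
    refine mem_tangentConeAt_of_add_smul_mem (Filter.tendsto_id (x := 𝓝[≠] (0 : ℂ))) ?_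
    refine Filter.Eventually.of_forall fun t => ?_
    simp [S, x]
  exact h3 hk

theorem mem_ker_mfderiv_src_iff (hI : I = 𝓘(ℂ, V × W)) (hcG : cG = chartedSpaceSelf (V × W))
    (x : W) (v : V × W) :
    v ∈ LinearMap.ker (mfderiv I 𝓘(ℂ, W) (GroupoidData.action act).src
      ((GroupoidData.action act).one x)).toLinearMap ↔ v.2 = 0 := by
  subst hI hcG
  have h : (mfderiv 𝓘(ℂ, V × W) 𝓘(ℂ, W) (GroupoidData.action act).src
      ((GroupoidData.action act).one x) : V × W →L[ℂ] W) = ContinuousLinearMap.snd ℂ V W :=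
    mfderiv_eq_fderiv.trans fderiv_snd
  exact Eq.congr_left (z := (0 : W)) (congrArg (fun L : V × W →L[ℂ] W => L v) h)

variable [hM : IsManifold I ω (V × W)]

/-- The fibres of the Lie algebroid of an action groupoid are copies of the Lie algebra. -/
def actionFibreEquiv (act : V →* Equiv.Perm W) (hI : I = 𝓘(ℂ, V × W))
    (hcG : cG = chartedSpaceSelf (V × W)) (x : W) :
    V ≃ₗ[ℂ] ((GroupoidData.action act).lieAlgebroid 𝓘(ℂ, W) I).Fib x where
  toFun k := ⟨((k, 0) : V × W), (mem_ker_mfderiv_src_iff hI hcG x _).2 rfl⟩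
  invFun v := (v.1 : V × W).1
  map_add' _ _ := Subtype.ext (Prod.ext rfl (add_zero (0 : W)).symm)
  map_smul' c _ := Subtype.ext (Prod.ext rfl (smul_zero c).symm)
  left_inv _ := rfl
  right_inv v := Subtype.ext (Prod.ext rfl ((mem_ker_mfderiv_src_iff hI hcG x _).1 v.2).symm)

theorem isHol_action_iff (hI : I = 𝓘(ℂ, V × W)) (hcG : cG = chartedSpaceSelf (V × W))
    {U : Set W} {s : W → V} :
    ((GroupoidData.action act).lieAlgebroid 𝓘(ℂ, W) I).IsHol U
      (fun x => actionFibreEquiv act hI hcG x (s x)) ↔ ContDiffOn ℂ ω s U := by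
  refine (contMDiffOn_tangent_iff_of_eq_self (v := fun x => ((s x, 0) : V × W)) rfl rfl hI hcG
    (contDiff_const.prodMk contDiff_id)).trans ?_
  exact ⟨fun h => h.fst, fun h => h.prodMk contDiffOn_const⟩

theorem anchor_action (hI : I = 𝓘(ℂ, V × W)) (hcG : cG = chartedSpaceSelf (V × W))
    (x : W) (k : V) :
    (((GroupoidData.action act).lieAlgebroid 𝓘(ℂ, W) I).anchor x
      (actionFibreEquiv act hI hcG x k) : W) = infinitesimalAction act x k :=
  congrArg (fun L : V × W →L[ℂ] W => L (k, 0))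
    (mfderiv_eq_fderiv_of_eq_self hI hcG rfl rfl (fun q : V × W => act q.1 q.2) (1, x))

/-- The bracket of an action Lie algebroid: besides the derivatives of the coefficients it contains
the bracket of the Lie algebra of the group, which is the antisymmetrised derivative of right
translation. -/
theorem bracket_action (h : IsHolomorphicAction act)
    (hI : I = 𝓘(ℂ, V × W)) (hcG : cG = chartedSpaceSelf (V × W)) {U : Set W} (hU : IsOpen U)
    {s t : W → V} (hs : ContDiffOn ℂ ω s U) (ht : ContDiffOn ℂ ω t U) {x : W} (hx : x ∈ U) :
    ((GroupoidData.action act).lieAlgebroid 𝓘(ℂ, W) I).bracket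
        (fun y => actionFibreEquiv act hI hcG y (s y))
        (fun y => actionFibreEquiv act hI hcG y (t y)) x =
      actionFibreEquiv act hI hcG x
        (fderiv ℂ t x (infinitesimalAction act x (s x))
          - fderiv ℂ s x (infinitesimalAction act x (t x))
          + (fderiv ℂ (rightDifferential (V := V)) 1 (s x) (t x)
            - fderiv ℂ (rightDifferential (V := V)) 1 (t x) (s x))) := by
  let X : (W → V) → V × W → V × W := fun r q =>
    (rightDifferential q.1 (r (act q.1 q.2)), 0)
  have hX : ∀ r : W → V, (GroupoidData.action act).rightInvariant I
      (fun y => (actionFibreEquiv act hI hcG y (r y)).1) = X r := fun r => funext fun q =>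
    rightTranslate_action h hI hcG q _
  have hX1 : ∀ r : W → V, X r (1, x) = (r x, 0) := fun r => by
    simp [X, rightDifferential_one]
  have hdX : ∀ r : W → V, DifferentiableAt ℂ r x → ∀ k : V, fderiv ℂ (X r) (1, x) (k, 0) =
      (fderiv ℂ (rightDifferential (V := V)) 1 k (r x)
        + fderiv ℂ r x (infinitesimalAction act x k), 0) := by
    intro r hr k
    have e1 : HasFDerivAt (fun q : V × W => rightDifferential q.1) _ ((1 : V), x) :=
      HasFDerivAt.comp (g := rightDifferential (V := V)) _
        (h.contDiff_rightDifferential.differentiable (by simp) 1).hasFDerivAt hasFDerivAt_fst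
    have hact : act 1 x = x := by simp
    have e2 : HasFDerivAt (fun q : V × W => r (act q.1 q.2)) _ ((1 : V), x) :=
      HasFDerivAt.comp (g := r) (f := fun q : V × W => act q.1 q.2) _
        (by rw [hact]; exact hr.hasFDerivAt)
        (h.contDiff_act.differentiable (by simp) _).hasFDerivAt
    have e3 : HasFDerivAt (X r) _ ((1 : V), x) :=
      (e1.clm_apply e2).prodMk (hasFDerivAt_const (0 : W) _)
    rw [e3.fderiv]
    simp [rightDifferential_one, infinitesimalAction, add_comm]
  have hs' : DifferentiableAt ℂ s x := (hs.contDiffAt (hU.mem_nhds hx)).differentiableAt (by simp)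
  have ht' : DifferentiableAt ℂ t x := (ht.contDiffAt (hU.mem_nhds hx)).differentiableAt (by simp)
  have key : (VectorField.mlieBracket I (M := V × W) (X s) (X t) (1, x) : V × W) =
      (fderiv ℂ t x (infinitesimalAction act x (s x))
          - fderiv ℂ s x (infinitesimalAction act x (t x))
          + (fderiv ℂ (rightDifferential (V := V)) 1 (s x) (t x)
            - fderiv ℂ (rightDifferential (V := V)) 1 (t x) (s x)), 0) := by
    rw [mlieBracket_eq_lieBracket_of_eq_self hI hcG, VectorField.lieBracket, hX1, hX1,
      hdX t ht', hdX s hs']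
    refine Prod.ext ?_ (sub_zero _)
    simp only [Prod.fst_sub]
    abel
  rw [← hX s, ← hX t] at key
  have hmem := (mem_ker_mfderiv_src_iff (act := act) hI hcG x _).2 (congrArg Prod.snd key)
  exact (dif_pos hmem).trans (Subtype.ext key)

/-- A Lie algebroid over `W` whose fibres are identified with `V`, compatibly with sections, anchor
and bracket, is the Lie algebroid of the action groupoid. -/
theorem isIso_lieAlgebroid_action (h : IsHolomorphicAction act)
    (hI : I = 𝓘(ℂ, V × W)) (hcG : cG = chartedSpaceSelf (V × W))
    {A : LieAlgebroidData 𝓘(ℂ, W) W} (θ : ∀ x, A.Fib x ≃ₗ[ℂ] V)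
    (hhol : ∀ (U : Set W) (σ : ∀ x, A.Fib x),
      A.IsHol U σ ↔ ContDiffOn ℂ ω (fun x => θ x (σ x)) U)
    (hanchor : ∀ x v, (A.anchor x v : W) = infinitesimalAction act x (θ x v))
    (hbracket : ∀ (U : Set W) (σ τ : ∀ x, A.Fib x), IsOpen U → A.IsHol U σ → A.IsHol U τ →
      ∀ x ∈ U, θ x (A.bracket σ τ x) =
        fderiv ℂ (fun y => θ y (τ y)) x (infinitesimalAction act x (θ x (σ x)))
          - fderiv ℂ (fun y => θ y (σ y)) x (infinitesimalAction act x (θ x (τ x)))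
          + (fderiv ℂ (rightDifferential (V := V)) 1 (θ x (σ x)) (θ x (τ x))
            - fderiv ℂ (rightDifferential (V := V)) 1 (θ x (τ x)) (θ x (σ x)))) :
    LieAlgebroidData.IsIso A ((GroupoidData.action act).lieAlgebroid 𝓘(ℂ, W) I)
      fun x => (θ x).trans (actionFibreEquiv act hI hcG x) where
  isHol_iff U σ _ := (hhol U σ).trans (isHol_action_iff hI hcG).symm
  anchor_eq x v := (anchor_action hI hcG x (θ x v)).trans (hanchor x v).symm
  bracket_eq U σ τ hU hσ hτ x hx :=
    (congrArg (actionFibreEquiv act hI hcG x) (hbracket U σ τ hU hσ hτ x hx)).trans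
      (bracket_action h hI hcG hU ((hhol U σ).1 hσ) ((hhol U τ).1 hτ) hx).symm

end

end ActionGroupoid

/-! ### The groups acting on `ℂ²` -/

section TrivialFamily

theorem isLieGroupoid_trivialFamily (W : Type) [NormedAddCommGroup W] [NormedSpace ℂ W]
    [FiniteDimensional ℂ W] :
    (GroupoidData.trivialFamily W).IsLieGroupoid 𝓘(ℂ, W) (𝓘(ℂ, W).prod 𝓘(ℂ, ℂ)) where
  finiteDimensional_obj := inferInstance
  finiteDimensional_arr := inferInstance
  boundaryless_obj := inferInstance
  boundaryless_arr := inferInstance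
  isManifold_obj := inferInstance
  isManifold_arr := inferInstance
  src_one _ := rfl
  tgt_one _ := rfl
  src_mul _ _ _ := rfl
  tgt_mul _ _ hgh := hgh.symm
  mul_assoc _ _ _ _ _ := Prod.ext rfl (add_assoc _ _ _)
  one_mul _ := Prod.ext rfl (zero_add _)
  mul_one _ := Prod.ext rfl (add_zero _)
  src_inv _ := rfl
  tgt_inv _ := rfl
  inv_mul _ := Prod.ext rfl (neg_add_cancel _)
  mul_inv _ := Prod.ext rfl (add_neg_cancel _)
  src_submersion := isSubmersion_of_eq_self modelWithCornersSelf_prod.symm chartedSpaceSelf_prod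
    rfl rfl (Equiv.refl _) contDiff_id contDiff_id (ContinuousLinearEquiv.refl ℂ (W × ℂ))
    fun _ => rfl
  tgt_submersion := isSubmersion_of_eq_self modelWithCornersSelf_prod.symm chartedSpaceSelf_prod
    rfl rfl (Equiv.refl _) contDiff_id contDiff_id (ContinuousLinearEquiv.refl ℂ (W × ℂ))
    fun _ => rfl
  one_hol := contMDiff_id.prodMk contMDiff_const
  inv_hol := contMDiff_fst.prodMk (contDiff_neg.contMDiff.comp contMDiff_snd)
  mul_hol := ContMDiff.contMDiffOn <| (contMDiff_fst.comp contMDiff_snd).prodMk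
    ((contMDiff_snd.comp contMDiff_fst).add (contMDiff_snd.comp contMDiff_snd))

end TrivialFamily

section Groups

/-- The vector space underlying the Heisenberg group, which also serves as its Lie algebra; the
addition is not the group law. -/
instance : NormedAddCommGroup Heis := inferInstanceAs (NormedAddCommGroup (ℂ × ℂ × ℂ))

instance : NormedSpace ℂ Heis := inferInstanceAs (NormedSpace ℂ (ℂ × ℂ × ℂ))

instance : FiniteDimensional ℂ Heis := inferInstanceAs (FiniteDimensional ℂ (ℂ × ℂ × ℂ))

instance : NormedAddCommGroup AddC2 := inferInstanceAs (NormedAddCommGroup (ℂ × ℂ))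

instance : NormedSpace ℂ AddC2 := inferInstanceAs (NormedSpace ℂ (ℂ × ℂ))

instance : FiniteDimensional ℂ AddC2 := inferInstanceAs (FiniteDimensional ℂ (ℂ × ℂ))

theorem isHolomorphicAction_heis : IsHolomorphicAction Heis.act where
  contDiff_mul := show ContDiff ℂ ω fun q : (ℂ × ℂ × ℂ) × (ℂ × ℂ × ℂ) =>
    (q.1.1 + q.2.1, q.1.2.1 + q.2.2.1, q.1.2.2 + q.2.2.2 + q.1.1 * q.2.2.1) by fun_prop
  contDiff_inv := show ContDiff ℂ ω fun q : ℂ × ℂ × ℂ =>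
    (-q.1, -q.2.1, -q.2.2 + q.1 * q.2.1) by fun_prop
  contDiff_act := show ContDiff ℂ ω fun q : (ℂ × ℂ × ℂ) × (ℂ × ℂ) =>
    (Complex.exp q.1.1 * q.2.1, Complex.exp q.1.2.1 * q.2.2) by fun_prop

theorem isHolomorphicAction_addC2 : IsHolomorphicAction AddC2.act where
  contDiff_mul := show ContDiff ℂ ω fun q : (ℂ × ℂ) × (ℂ × ℂ) => q.1 + q.2 by fun_prop
  contDiff_inv := show ContDiff ℂ ω fun q : ℂ × ℂ => -q by fun_prop
  contDiff_act := show ContDiff ℂ ω fun q : (ℂ × ℂ) × (ℂ × ℂ) =>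
    (Complex.exp q.1.1 * q.2.1, Complex.exp q.1.2 * q.2.2) by fun_prop

theorem infinitesimalAction_heis (x : ℂ × ℂ) (k : Heis) :
    infinitesimalAction Heis.act x k = logAnchor x (k.a, k.b) := by
  let p : (ℂ × ℂ × ℂ) × (ℂ × ℂ) := ((0, 0, 0), x)
  have h1 : HasFDerivAt (fun q : (ℂ × ℂ × ℂ) × (ℂ × ℂ) => q.1.1) _ p :=
    (hasFDerivAt_fst (𝕜 := ℂ) (p := p)).fst
  have h2 : HasFDerivAt (fun q : (ℂ × ℂ × ℂ) × (ℂ × ℂ) => q.1.2.1) _ p :=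
    (hasFDerivAt_fst (𝕜 := ℂ) (p := p)).snd.fst
  have h : HasFDerivAt (fun q : (ℂ × ℂ × ℂ) × (ℂ × ℂ) =>
      (Complex.exp q.1.1 * q.2.1, Complex.exp q.1.2.1 * q.2.2)) _ p :=
    (h1.cexp.mul (hasFDerivAt_snd (𝕜 := ℂ) (p := p)).fst).prodMk
      (h2.cexp.mul (hasFDerivAt_snd (𝕜 := ℂ) (p := p)).snd)
  refine (congrArg (fun L : (ℂ × ℂ × ℂ) × (ℂ × ℂ) →L[ℂ] ℂ × ℂ => L ((k.a, k.b, k.c), 0))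
    h.fderiv).trans ?_
  simp [p, logAnchor_apply]

theorem infinitesimalAction_addC2 (x : ℂ × ℂ) (k : AddC2) :
    infinitesimalAction AddC2.act x k = logAnchor x k.val := by
  let p : (ℂ × ℂ) × (ℂ × ℂ) := ((0, 0), x)
  have h1 : HasFDerivAt (fun q : (ℂ × ℂ) × (ℂ × ℂ) => q.1.1) _ p :=
    (hasFDerivAt_fst (𝕜 := ℂ) (p := p)).fst
  have h2 : HasFDerivAt (fun q : (ℂ × ℂ) × (ℂ × ℂ) => q.1.2) _ p :=
    (hasFDerivAt_fst (𝕜 := ℂ) (p := p)).snd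
  have h : HasFDerivAt (fun q : (ℂ × ℂ) × (ℂ × ℂ) =>
      (Complex.exp q.1.1 * q.2.1, Complex.exp q.1.2 * q.2.2)) _ p :=
    (h1.cexp.mul (hasFDerivAt_snd (𝕜 := ℂ) (p := p)).fst).prodMk
      (h2.cexp.mul (hasFDerivAt_snd (𝕜 := ℂ) (p := p)).snd)
  refine (congrArg (fun L : (ℂ × ℂ) × (ℂ × ℂ) →L[ℂ] ℂ × ℂ => L (k.val, 0))
    h.fderiv).trans ?_
  simp [p, logAnchor_apply]

theorem rightDifferential_heis (g k : Heis) :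
    rightDifferential g k = ((k.a, k.b, k.c + k.a * g.b) : ℂ × ℂ × ℂ) := by
  have h1 : HasFDerivAt (fun q : ℂ × ℂ × ℂ => q.1) _ ((0 : ℂ), (0 : ℂ), (0 : ℂ)) :=
    hasFDerivAt_fst (𝕜 := ℂ)
  have h2 : HasFDerivAt (fun q : ℂ × ℂ × ℂ => q.2.1) _ ((0 : ℂ), (0 : ℂ), (0 : ℂ)) :=
    (hasFDerivAt_snd (𝕜 := ℂ) (E := ℂ) (F := ℂ × ℂ) (p := (0, 0, 0))).fst
  have h3 : HasFDerivAt (fun q : ℂ × ℂ × ℂ => q.2.2) _ ((0 : ℂ), (0 : ℂ), (0 : ℂ)) :=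
    (hasFDerivAt_snd (𝕜 := ℂ) (E := ℂ) (F := ℂ × ℂ) (p := (0, 0, 0))).snd
  have h : HasFDerivAt (fun q : ℂ × ℂ × ℂ => (q.1 + g.a, q.2.1 + g.b, q.2.2 + g.c + q.1 * g.b)) _
      ((0 : ℂ), (0 : ℂ), (0 : ℂ)) :=
    (h1.add_const g.a).prodMk ((h2.add_const g.b).prodMk ((h3.add_const g.c).add
      (h1.mul_const g.b)))
  refine (congrArg (fun L : ℂ × ℂ × ℂ →L[ℂ] ℂ × ℂ × ℂ => L (k.a, k.b, k.c)) h.fderiv).trans ?_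
  simp [mul_comm]

/-- The derivative of right translation in the Heisenberg group is the cocycle `(k, l) ↦ l_a k_b`,
whose antisymmetrisation is `-dx ∧ dy / (xy)` in logarithmic coordinates. -/
theorem fderiv_rightDifferential_heis (k l : Heis) :
    fderiv ℂ (rightDifferential (V := Heis)) 1 k l = ((0, 0, l.a * k.b) : ℂ × ℂ × ℂ) := by
  have h0 := (isHolomorphicAction_heis.contDiff_rightDifferential.differentiable
    (by simp) 1).hasFDerivAt
  have h := h0.clm_apply (hasFDerivAt_const l (1 : Heis))
  have h2 : HasFDerivAt (fun q : ℂ × ℂ × ℂ => q.2.1) _ ((0 : ℂ), (0 : ℂ), (0 : ℂ)) :=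
    (hasFDerivAt_snd (𝕜 := ℂ) (E := ℂ) (F := ℂ × ℂ) (p := (0, 0, 0))).fst
  have h' : HasFDerivAt (fun q : ℂ × ℂ × ℂ => (l.a, l.b, l.c + l.a * q.2.1)) _
      ((0 : ℂ), (0 : ℂ), (0 : ℂ)) :=
    (hasFDerivAt_const l.a _).prodMk ((hasFDerivAt_const l.b _).prodMk
      ((h2.const_mul l.a).const_add l.c))
  have e : (fun g : Heis => rightDifferential g l) =
      fun q : ℂ × ℂ × ℂ => (l.a, l.b, l.c + l.a * q.2.1) :=
    funext fun g => rightDifferential_heis g l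
  have key := congrArg (fun L : Heis →L[ℂ] Heis => L k) (h.unique (e ▸ h'))
  refine Eq.trans ?_ (key.trans ?_)
  · simp
  · change ((0 : ℂ), (0 : ℂ), l.a * k.b) = _
    rfl

theorem fderiv_rightDifferential_addC2 (k l : AddC2) :
    fderiv ℂ (rightDifferential (V := AddC2)) 1 k l = 0 := by
  have h : ∀ g : AddC2, rightDifferential g = ContinuousLinearMap.id ℂ AddC2 := fun g =>
    ((hasFDerivAt_id (𝕜 := ℂ) (0 : ℂ × ℂ)).add_const g.val).fderiv
  rw [funext h]
  simp

end Groups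

/-! ### The Heisenberg extension -/

section HeisenbergExtension

/-- The inclusion `heisIncl ε` completed by the coordinates `a`, `b` to a linear isomorphism. -/
def heisInclEquiv (ε : ℂ) (hε : ε ≠ 0) :
    (((ℂ × ℂ) × ℂ) × (ℂ × ℂ)) ≃L[ℂ] (ℂ × ℂ × ℂ) × (ℂ × ℂ) :=
  LinearEquiv.toContinuousLinearEquiv
    { toFun := fun v => ((v.2.1, v.2.2, ε * v.1.2), v.1.1)
      invFun := fun v => ((v.2, ε⁻¹ * v.1.2.2), (v.1.1, v.1.2.1))
      map_add' := fun v w => by ext <;> simp [mul_add]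
      map_smul' := fun c v => by ext <;> simp [mul_left_comm]
      left_inv := fun v => by ext <;> simp [hε]
      right_inv := fun v => by ext <;> simp [hε] }

/-- The projection `heisProj` completed by the coordinate `c` to a linear isomorphism. -/
def heisProjEquiv : ((ℂ × ℂ × ℂ) × (ℂ × ℂ)) ≃L[ℂ] ((ℂ × ℂ) × (ℂ × ℂ)) × ℂ :=
  LinearEquiv.toContinuousLinearEquiv
    { toFun := fun v => (((v.1.1, v.1.2.1), v.2), v.1.2.2)
      invFun := fun v => ((v.1.1.1, v.1.1.2, v.2), v.1.2)
      map_add' := fun _ _ => rfl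
      map_smul' := fun _ _ => rfl
      left_inv := fun _ => rfl
      right_inv := fun _ => rfl }

theorem contMDiff_heisIncl (ε : ℂ) :
    ContMDiff (𝓘(ℂ, ℂ × ℂ).prod 𝓘(ℂ, ℂ)) (𝓘(ℂ, ℂ × ℂ × ℂ).prod 𝓘(ℂ, ℂ × ℂ)) ω
      (heisIncl ε) :=
  (contMDiff_iff_contDiff_of_eq_self (E := (ℂ × ℂ) × ℂ) (F := (ℂ × ℂ × ℂ) × (ℂ × ℂ))
    modelWithCornersSelf_prod.symm chartedSpaceSelf_prod modelWithCornersSelf_prod.symm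
    chartedSpaceSelf_prod).2
  (show ContDiff ℂ ω fun m : (ℂ × ℂ) × ℂ => (((0 : ℂ), (0 : ℂ), ε * m.2), m.1) by fun_prop)

theorem contMDiff_heisProj :
    ContMDiff (𝓘(ℂ, ℂ × ℂ × ℂ).prod 𝓘(ℂ, ℂ × ℂ)) (𝓘(ℂ, ℂ × ℂ).prod 𝓘(ℂ, ℂ × ℂ)) ω
      heisProj :=
  (contMDiff_iff_contDiff_of_eq_self (E := (ℂ × ℂ × ℂ) × (ℂ × ℂ)) (F := (ℂ × ℂ) × (ℂ × ℂ))
    modelWithCornersSelf_prod.symm chartedSpaceSelf_prod modelWithCornersSelf_prod.symm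
    chartedSpaceSelf_prod).2
  (show ContDiff ℂ ω fun q : (ℂ × ℂ × ℂ) × (ℂ × ℂ) => ((q.1.1, q.1.2.1), q.2) by fun_prop)

theorem heisIncl_morphism (ε : ℂ) :
    GroupoidData.IsMorphism (𝓘(ℂ, ℂ × ℂ).prod 𝓘(ℂ, ℂ)) (𝓘(ℂ, ℂ × ℂ × ℂ).prod 𝓘(ℂ, ℂ × ℂ))
      (GroupoidData.trivialFamily (ℂ × ℂ)) (GroupoidData.action Heis.act) (heisIncl ε) where
  hol := contMDiff_heisIncl ε
  src _ := rfl
  tgt m := by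
    simp [GroupoidData.action, GroupoidData.trivialFamily, heisIncl, Heis.act, Heis.a, Heis.b]
  one x := Prod.ext (Heis.ext rfl rfl (mul_zero ε)) rfl
  mul m n _ := by
    refine Prod.ext (Heis.ext (add_zero (0 : ℂ)).symm (add_zero (0 : ℂ)).symm ?_) rfl
    change ε * (m.2 + n.2) = ε * m.2 + ε * n.2 + 0 * 0
    ring

theorem heisProj_morphism :
    GroupoidData.IsMorphism (𝓘(ℂ, ℂ × ℂ × ℂ).prod 𝓘(ℂ, ℂ × ℂ)) (𝓘(ℂ, ℂ × ℂ).prod 𝓘(ℂ, ℂ × ℂ))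
      (GroupoidData.action Heis.act) (GroupoidData.action AddC2.act) heisProj where
  hol := contMDiff_heisProj
  src _ := rfl
  tgt _ := rfl
  one _ := rfl
  mul _ _ _ := rfl

/-- The arrows over a fixed arrow of `ℂ² ⋉ ℂ²` differ only in the coordinate `c`. -/
theorem heis_mul_incl (ε c : ℂ) (e : Heis × (ℂ × ℂ)) (x : ℂ × ℂ) :
    (GroupoidData.action Heis.act).mul e (heisIncl ε (x, c)) =
      (((e.1.a, e.1.b, e.1.c + ε * c) : ℂ × ℂ × ℂ), x) := by
  refine Prod.ext (Heis.ext (add_zero _) (add_zero _) ?_) rfl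
  change e.1.c + ε * c + e.1.a * 0 = e.1.c + ε * c
  ring

/-- The projection has the global section `c = 0`, so the extension is trivial as a principal bundle;
it is central because the coordinate `c` spans the centre of the Heisenberg group. -/
theorem heis_isCentralExtension {ε : ℂ} (hε : ε ≠ 0) :
    GroupoidData.IsCentralExtension 𝓘(ℂ, ℂ × ℂ)
      (𝓘(ℂ, ℂ × ℂ × ℂ).prod 𝓘(ℂ, ℂ × ℂ)) (𝓘(ℂ, ℂ × ℂ).prod 𝓘(ℂ, ℂ × ℂ))
      (GroupoidData.action Heis.act) (GroupoidData.action AddC2.act) (heisIncl ε) heisProj where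
  isLieGroupoid_kernel := isLieGroupoid_trivialFamily (ℂ × ℂ)
  isLieGroupoid_total := isLieGroupoid_action isHolomorphicAction_heis
    modelWithCornersSelf_prod.symm chartedSpaceSelf_prod
  isLieGroupoid_base := isLieGroupoid_action isHolomorphicAction_addC2
    modelWithCornersSelf_prod.symm chartedSpaceSelf_prod
  incl_morphism := heisIncl_morphism ε
  proj_morphism := heisProj_morphism
  incl_embedding := isSmoothEmbedding_of_eq_self (E := (ℂ × ℂ) × ℂ) (F := (ℂ × ℂ × ℂ) × (ℂ × ℂ))
    modelWithCornersSelf_prod.symm chartedSpaceSelf_prod modelWithCornersSelf_prod.symm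
    chartedSpaceSelf_prod (heisInclEquiv ε hε) fun _ => rfl
  proj_surjective g := ⟨(((g.1.val.1, g.1.val.2, (0 : ℂ)) : ℂ × ℂ × ℂ), g.2), rfl⟩
  proj_submersion := isSubmersion_of_eq_self (E := (ℂ × ℂ × ℂ) × (ℂ × ℂ))
    (F := (ℂ × ℂ) × (ℂ × ℂ))
    modelWithCornersSelf_prod.symm chartedSpaceSelf_prod modelWithCornersSelf_prod.symm
    chartedSpaceSelf_prod (Equiv.refl _) contDiff_id contDiff_id heisProjEquiv fun _ => rfl
  exact := by
    ext e
    constructor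
    · rintro ⟨m, rfl⟩
      exact ⟨m.1, rfl⟩
    · rintro ⟨x, hx⟩
      have h1 : (e.1.a, e.1.b) = ((0 : ℂ), (0 : ℂ)) :=
        congrArg (fun g : AddC2 × (ℂ × ℂ) => AddC2.val g.1) hx
      refine ⟨(e.2, ε⁻¹ * e.1.c), Prod.ext (Heis.ext ?_ ?_ ?_) rfl⟩
      · exact (congrArg Prod.fst h1).symm
      · exact (congrArg Prod.snd h1).symm
      · exact mul_inv_cancel_left₀ hε _
  central e c := by
    rw [heis_mul_incl]
    refine Prod.ext (Heis.ext (zero_add _).symm (zero_add _).symm ?_) rfl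
    change e.1.c + ε * c = ε * c + e.1.c + 0 * e.1.b
    ring
  principal e e' h := by
    have h1 : (e.1.a, e.1.b) = (e'.1.a, e'.1.b) :=
      congrArg (fun g : AddC2 × (ℂ × ℂ) => AddC2.val g.1) h
    have h2 : e.2 = e'.2 := congrArg (fun g : AddC2 × (ℂ × ℂ) => g.2) h
    refine ⟨ε⁻¹ * (e'.1.c - e.1.c), ?_, fun c hc => ?_⟩
    · refine Eq.trans ?_ (heis_mul_incl ε _ e e.2).symm
      refine Prod.ext (Heis.ext (congrArg Prod.fst h1).symm (congrArg Prod.snd h1).symm ?_) h2.symm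
      change e'.1.c = e.1.c + ε * (ε⁻¹ * (e'.1.c - e.1.c))
      rw [mul_inv_cancel_left₀ hε]
      ring
    · have h3 : e'.1.c = e.1.c + ε * c :=
        congrArg (fun q : Heis × (ℂ × ℂ) => Heis.c q.1) (hc.trans (heis_mul_incl ε c e e.2))
      rw [h3, add_sub_cancel_left, inv_mul_cancel_left₀ hε]
  locally_trivial g := by
    refine ⟨Set.univ, fun h => (((h.1.val.1, h.1.val.2, (0 : ℂ)) : ℂ × ℂ × ℂ), h.2),
      fun e => ε⁻¹ * e.1.c, isOpen_univ, Set.mem_univ _, ?_, ?_, fun _ _ => rfl, fun e _ => ?_⟩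
    · refine ContMDiff.contMDiffOn <| (contMDiff_iff_contDiff_of_eq_self
        (E := (ℂ × ℂ) × (ℂ × ℂ)) (F := (ℂ × ℂ × ℂ) × (ℂ × ℂ))
        modelWithCornersSelf_prod.symm chartedSpaceSelf_prod modelWithCornersSelf_prod.symm
        chartedSpaceSelf_prod).2 ?_
      exact show ContDiff ℂ ω fun h : (ℂ × ℂ) × (ℂ × ℂ) => ((h.1.1, h.1.2, (0 : ℂ)), h.2) by
        fun_prop
    · refine ContMDiff.contMDiffOn <| (contMDiff_iff_contDiff_of_eq_self
        (E := (ℂ × ℂ × ℂ) × (ℂ × ℂ)) (F := ℂ)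
        modelWithCornersSelf_prod.symm chartedSpaceSelf_prod rfl rfl).2 ?_
      exact show ContDiff ℂ ω fun e : (ℂ × ℂ × ℂ) × (ℂ × ℂ) => ε⁻¹ * e.1.2.2 by fun_prop
    · rw [heis_mul_incl]
      refine Prod.ext (Heis.ext rfl rfl ?_) rfl
      change e.1.c = 0 + ε * (ε⁻¹ * e.1.c)
      rw [mul_inv_cancel_left₀ hε, zero_add]

/-- The Lie algebra of the Heisenberg group as the sum of `ℂ²` and its centre, the latter identified
with `ℂ` by `c ↦ (0, 0, ε c)`. -/
def heisLieEquiv (ε : ℂ) (hε : ε ≠ 0) : ((ℂ × ℂ) × ℂ) ≃L[ℂ] Heis :=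
  show ((ℂ × ℂ) × ℂ) ≃L[ℂ] ℂ × ℂ × ℂ from
  LinearEquiv.toContinuousLinearEquiv
    { toFun := fun v => (v.1.1, v.1.2, ε * v.2)
      invFun := fun v => ((v.1, v.2.1), ε⁻¹ * v.2.2)
      map_add' := fun v w => by ext <;> simp [mul_add]
      map_smul' := fun c v => by ext <;> simp [mul_left_comm]
      left_inv := fun v => by ext <;> simp [hε]
      right_inv := fun v => by ext <;> simp [hε] }

theorem isHol_twist_logTangent_iff {φ : ℂ × ℂ →ₗ[ℂ] ℂ × ℂ →ₗ[ℂ] ℂ} {U : Set (ℂ × ℂ)}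
    {σ : ℂ × ℂ → (ℂ × ℂ) × ℂ} :
    (logTangent.twist fun _ => φ).IsHol U σ ↔ ContDiffOn ℂ ω σ U :=
  ⟨fun h => ContDiffOn.prodMk h.1 (contMDiffOn_iff_contDiffOn.1 h.2),
    fun h => ⟨h.fst, contMDiffOn_iff_contDiffOn.2 h.snd⟩⟩

/-- On coefficients, both components of the bracket twisted by a constant form are differentiated in
the same way, so that it only adds `φ` to the bracket of `T(-log D)`. -/
theorem twist_logTangent_bracket (φ : ℂ × ℂ →ₗ[ℂ] ℂ × ℂ →ₗ[ℂ] ℂ)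
    {σ τ : ℂ × ℂ → (ℂ × ℂ) × ℂ} {x : ℂ × ℂ}
    (hσ : DifferentiableAt ℂ σ x) (hτ : DifferentiableAt ℂ τ x) :
    ((logTangent.twist fun _ => φ).bracket σ τ x : (ℂ × ℂ) × ℂ) =
      (fderiv ℂ τ x (logAnchor x (σ x).1) - fderiv ℂ σ x (logAnchor x (τ x).1))
        + (0, φ (σ x).1 (τ x).1) := by
  have h1 : ∀ ρ : ℂ × ℂ → (ℂ × ℂ) × ℂ, DifferentiableAt ℂ ρ x → ∀ v,
      fderiv ℂ (fun y => (ρ y).1) x v = (fderiv ℂ ρ x v).1 := by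
    intro ρ hρ v
    rw [hρ.hasFDerivAt.fst.fderiv]
    rfl
  have h2 : ∀ ρ : ℂ × ℂ → (ℂ × ℂ) × ℂ, DifferentiableAt ℂ ρ x → ∀ α : ℂ × ℂ → ℂ × ℂ,
      logTangent.deriv α (fun y => (ρ y).2) x = (fderiv ℂ ρ x (logAnchor x (α x))).2 := by
    intro ρ hρ α
    refine (logTangent_deriv_apply α _ x).trans ?_
    rw [logDerivation, hρ.hasFDerivAt.snd.fderiv]
    rfl
  refine Prod.ext ?_ ?_
  · refine (congrArg₂ (· - ·) (h1 τ hτ _) (h1 σ hσ _)).trans ?_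
    exact (add_zero _).symm
  · exact congrArg (· + φ (σ x).1 (τ x).1) (congrArg₂ (· - ·) (h2 τ hτ _) (h2 σ hσ _))

/-- The bracket of the Lie algebroid of `H ⋉ ℂ²` is the bracket twisted by a `2`-form `φ` with
`ε φ = -dx ∧ dy / (xy)`. -/
theorem heisLieEquiv_bracket {ε : ℂ} (hε : ε ≠ 0) {φ : ℂ × ℂ →ₗ[ℂ] ℂ × ℂ →ₗ[ℂ] ℂ}
    (hφ : ∀ u v, ε * φ u v = -frameForm u v) {σ τ : ℂ × ℂ → (ℂ × ℂ) × ℂ} {x : ℂ × ℂ}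
    (hσ : DifferentiableAt ℂ σ x) (hτ : DifferentiableAt ℂ τ x) :
    heisLieEquiv ε hε ((fderiv ℂ τ x (logAnchor x (σ x).1) - fderiv ℂ σ x (logAnchor x (τ x).1))
        + (0, φ (σ x).1 (τ x).1)) =
      fderiv ℂ (fun y => heisLieEquiv ε hε (τ y)) x
          (infinitesimalAction Heis.act x (heisLieEquiv ε hε (σ x)))
        - fderiv ℂ (fun y => heisLieEquiv ε hε (σ y)) x
          (infinitesimalAction Heis.act x (heisLieEquiv ε hε (τ x)))
        + (fderiv ℂ (rightDifferential (V := Heis)) 1 (heisLieEquiv ε hε (σ x))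
            (heisLieEquiv ε hε (τ x))
          - fderiv ℂ (rightDifferential (V := Heis)) 1 (heisLieEquiv ε hε (τ x))
            (heisLieEquiv ε hε (σ x))) := by
  have hd : ∀ ρ : ℂ × ℂ → (ℂ × ℂ) × ℂ, DifferentiableAt ℂ ρ x → ∀ v,
      fderiv ℂ (fun y => heisLieEquiv ε hε (ρ y)) x v = heisLieEquiv ε hε (fderiv ℂ ρ x v) := by
    intro ρ hρ v
    have h : HasFDerivAt (fun y => heisLieEquiv ε hε (ρ y)) _ x :=
      (heisLieEquiv ε hε : ((ℂ × ℂ) × ℂ) →L[ℂ] Heis).hasFDerivAt.comp x hρ.hasFDerivAt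
    rw [h.fderiv]
    rfl
  have ha : ∀ v : (ℂ × ℂ) × ℂ, infinitesimalAction Heis.act x (heisLieEquiv ε hε v) =
      logAnchor x v.1 := fun v => infinitesimalAction_heis x (heisLieEquiv ε hε v)
  rw [hd τ hτ, hd σ hσ, ha, ha, fderiv_rightDifferential_heis, fderiv_rightDifferential_heis]
  set p := fderiv ℂ τ x (logAnchor x (σ x).1)
  set q := fderiv ℂ σ x (logAnchor x (τ x).1)
  refine Heis.ext ?_ ?_ ?_
  · change p.1.1 - q.1.1 + 0 = p.1.1 - q.1.1 + ((0 : ℂ) - 0)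
    ring
  · change p.1.2 - q.1.2 + 0 = p.1.2 - q.1.2 + ((0 : ℂ) - 0)
    ring
  · change ε * (p.2 - q.2 + φ (σ x).1 (τ x).1) =
      ε * p.2 - ε * q.2 + ((τ x).1.1 * (σ x).1.2 - (σ x).1.1 * (τ x).1.2)
    have := hφ (σ x).1 (τ x).1
    rw [frameForm_apply] at this
    linear_combination this

/-- The Lie algebroid of `H ⋉ ℂ²` is the sum of `T(-log D)` and the trivial line bundle, with bracket
twisted by `φ = -ε⁻¹ dx ∧ dy / (xy)`, when the centre of the Lie algebra of `H` is identified with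
`ℂ` by `c ↦ (0, 0, ε c)`. -/
theorem isIso_lieAlgebroid_heis {ε : ℂ} (hε : ε ≠ 0) {φ : ℂ × ℂ →ₗ[ℂ] ℂ × ℂ →ₗ[ℂ] ℂ}
    (hφ : ∀ u v, ε * φ u v = -frameForm u v) :
    LieAlgebroidData.IsIso (logTangent.twist fun _ => φ)
      ((GroupoidData.action Heis.act).lieAlgebroid 𝓘(ℂ, ℂ × ℂ)
        (𝓘(ℂ, ℂ × ℂ × ℂ).prod 𝓘(ℂ, ℂ × ℂ)))
      fun x => (heisLieEquiv ε hε).toLinearEquiv.trans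
        (actionFibreEquiv (V := Heis) (I := 𝓘(ℂ, Heis).prod 𝓘(ℂ, ℂ × ℂ))
          (cG := prodChartedSpace Heis Heis (ℂ × ℂ) (ℂ × ℂ))
    (hM := inferInstanceAs (IsManifold (𝓘(ℂ, ℂ × ℂ × ℂ).prod 𝓘(ℂ, ℂ × ℂ)) ω (Heis × (ℂ × ℂ)))) Heis.act
          modelWithCornersSelf_prod.symm chartedSpaceSelf_prod x) := by
  refine isIso_lieAlgebroid_action (V := Heis) (I := 𝓘(ℂ, Heis).prod 𝓘(ℂ, ℂ × ℂ))
    (cG := prodChartedSpace Heis Heis (ℂ × ℂ) (ℂ × ℂ))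
    (hM := inferInstanceAs (IsManifold (𝓘(ℂ, ℂ × ℂ × ℂ).prod 𝓘(ℂ, ℂ × ℂ)) ω (Heis × (ℂ × ℂ)))) isHolomorphicAction_heis
    modelWithCornersSelf_prod.symm chartedSpaceSelf_prod
    (A := logTangent.twist fun _ => φ) (fun _ => (heisLieEquiv ε hε).toLinearEquiv) ?_ ?_ ?_
  · intro U σ
    exact isHol_twist_logTangent_iff.trans (heisLieEquiv ε hε).comp_contDiffOn_iff.symm
  · exact fun x v => (infinitesimalAction_heis x (heisLieEquiv ε hε v)).symm
  · intro U σ τ hU hσ hτ x hx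
    have hσ' := (isHol_twist_logTangent_iff.1 hσ).contDiffAt (hU.mem_nhds hx)
    have hτ' := (isHol_twist_logTangent_iff.1 hτ).contDiffAt (hU.mem_nhds hx)
    exact (congrArg (heisLieEquiv ε hε) (twist_logTangent_bracket φ
      (hσ'.differentiableAt (by simp)) (hτ'.differentiableAt (by simp)))).trans
      (heisLieEquiv_bracket hε hφ (hσ'.differentiableAt (by simp)) (hτ'.differentiableAt (by simp)))

/-- The Lie algebroid of `ℂ² ⋉ ℂ²` is `T(-log D)`: the generators of the two factors act by `x ∂_x`
and `y ∂_y`. -/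
theorem isIso_lieAlgebroid_addC2 :
    LieAlgebroidData.IsIso logTangent
      ((GroupoidData.action AddC2.act).lieAlgebroid 𝓘(ℂ, ℂ × ℂ)
        (𝓘(ℂ, ℂ × ℂ).prod 𝓘(ℂ, ℂ × ℂ)))
      fun x => (LinearEquiv.refl ℂ (ℂ × ℂ)).trans
        (actionFibreEquiv (V := AddC2) (I := 𝓘(ℂ, AddC2).prod 𝓘(ℂ, ℂ × ℂ))
          (cG := prodChartedSpace AddC2 AddC2 (ℂ × ℂ) (ℂ × ℂ))
    (hM := inferInstanceAs (IsManifold (𝓘(ℂ, ℂ × ℂ).prod 𝓘(ℂ, ℂ × ℂ)) ω (AddC2 × (ℂ × ℂ)))) AddC2.act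
          modelWithCornersSelf_prod.symm chartedSpaceSelf_prod x) := by
  refine isIso_lieAlgebroid_action (V := AddC2) (I := 𝓘(ℂ, AddC2).prod 𝓘(ℂ, ℂ × ℂ))
    (cG := prodChartedSpace AddC2 AddC2 (ℂ × ℂ) (ℂ × ℂ))
    (hM := inferInstanceAs (IsManifold (𝓘(ℂ, ℂ × ℂ).prod 𝓘(ℂ, ℂ × ℂ)) ω (AddC2 × (ℂ × ℂ)))) isHolomorphicAction_addC2
    modelWithCornersSelf_prod.symm chartedSpaceSelf_prod
    (A := logTangent) (fun _ => LinearEquiv.refl ℂ (ℂ × ℂ)) ?_ ?_ ?_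
  · exact fun U σ => Iff.rfl
  · exact fun x v => (infinitesimalAction_addC2 x _).symm
  · intro U σ τ _ _ _ x _
    have hk : ∀ ρ : ℂ × ℂ → ℂ × ℂ, infinitesimalAction AddC2.act x (ρ x : ℂ × ℂ) =
        logAnchor x (ρ x) := fun ρ => infinitesimalAction_addC2 x _
    have h0 : ∀ k l : AddC2, fderiv ℂ (rightDifferential (V := AddC2)) 1 k l
        - fderiv ℂ (rightDifferential (V := AddC2)) 1 l k = 0 := fun k l => by
      rw [fderiv_rightDifferential_addC2, fderiv_rightDifferential_addC2, sub_zero]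
    refine Eq.trans ?_ (congrArg₂ (· + ·) rfl (h0 (σ x) (τ x)).symm)
    refine Eq.trans ?_ (add_zero _).symm
    exact congrArg₂ (· - ·) (congrArg (fderiv ℂ τ x) (hk σ).symm)
      (congrArg (fderiv ℂ σ x) (hk τ).symm)

/-- With the centre of the Heisenberg group identified with `ℂ` by `c ↦ ε c`, the extension of
action groupoids integrates the one defined by the `2`-form `-ε⁻¹ dx ∧ dy / (xy)`. -/
theorem heis_integrates {ε : ℂ} (hε : ε ≠ 0) {φ : ℂ × ℂ →ₗ[ℂ] ℂ × ℂ →ₗ[ℂ] ℂ}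
    (hφ : ∀ u v, ε * φ u v = -frameForm u v) :
    GroupoidData.Integrates 𝓘(ℂ, ℂ × ℂ)
      (𝓘(ℂ, ℂ × ℂ × ℂ).prod 𝓘(ℂ, ℂ × ℂ)) (𝓘(ℂ, ℂ × ℂ).prod 𝓘(ℂ, ℂ × ℂ))
      (GroupoidData.action Heis.act) (GroupoidData.action AddC2.act) (heisIncl ε) heisProj
      (logTangent.twist fun _ => φ) logTangent
      (fun _ => LinearMap.inr ℂ _ ℂ) (fun _ => LinearMap.fst ℂ _ ℂ) := by
  refine ⟨_, _, isIso_lieAlgebroid_heis hε hφ, isIso_lieAlgebroid_addC2, fun x c => ?_,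
    fun x v => ?_⟩
  · have h : HasFDerivAt (fun m : (ℂ × ℂ) × ℂ => (((0 : ℂ), (0 : ℂ), ε * m.2), m.1)) _
        ((x, 0) : (ℂ × ℂ) × ℂ) :=
      ((hasFDerivAt_const (0 : ℂ) _).prodMk ((hasFDerivAt_const (0 : ℂ) _).prodMk
        ((hasFDerivAt_snd (𝕜 := ℂ)).const_mul ε))).prodMk (hasFDerivAt_fst (𝕜 := ℂ))
    refine Eq.trans ?_ (congrArg
      (fun L : (ℂ × ℂ) × ℂ →L[ℂ] (ℂ × ℂ × ℂ) × (ℂ × ℂ) => L (0, c))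
      ((mfderiv_eq_fderiv_of_eq_self (E := (ℂ × ℂ) × ℂ) (F := (ℂ × ℂ × ℂ) × (ℂ × ℂ))
        modelWithCornersSelf_prod.symm chartedSpaceSelf_prod modelWithCornersSelf_prod.symm
        chartedSpaceSelf_prod (heisIncl ε) (x, 0)).trans h.fderiv)).symm
    rfl
  · have h := ((ContinuousLinearMap.fst ℂ ((ℂ × ℂ) × (ℂ × ℂ)) ℂ).comp
      (heisProjEquiv : (ℂ × ℂ × ℂ) × (ℂ × ℂ) →L[ℂ] ((ℂ × ℂ) × (ℂ × ℂ)) × ℂ)).hasFDerivAt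
      (x := (((0 : ℂ), (0 : ℂ), (0 : ℂ)), x))
    refine Eq.trans ?_ (congrArg
      (fun L : (ℂ × ℂ × ℂ) × (ℂ × ℂ) →L[ℂ] (ℂ × ℂ) × (ℂ × ℂ) =>
        L ((v.1.1, v.1.2, ε * v.2), 0))
      ((mfderiv_eq_fderiv_of_eq_self (E := (ℂ × ℂ × ℂ) × (ℂ × ℂ)) (F := (ℂ × ℂ) × (ℂ × ℂ))
        modelWithCornersSelf_prod.symm chartedSpaceSelf_prod modelWithCornersSelf_prod.symm
        chartedSpaceSelf_prod heisProj (((0 : ℂ), (0 : ℂ), (0 : ℂ)), x)).trans h.fderiv)).symm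
    rfl

end HeisenbergExtension

/-! ### The extension integrating the logarithmic form -/

theorem Heis.toMatrix_injective : Function.Injective Heis.toMatrix := fun _ _ hgh =>
  Heis.ext (congrFun (congrFun hgh 0) 1) (congrFun (congrFun hgh 1) 2)
    (congrFun (congrFun hgh 0) 2)

theorem Heis.toMatrix_mul (g h : Heis) : (g * h).toMatrix = g.toMatrix * h.toMatrix := by
  ext i j
  fin_cases i <;> fin_cases j <;> simp [Heis.toMatrix, Matrix.mul_apply, Fin.sum_univ_three]
  · ring
  · ring
  · ring

theorem Heis.range_toMatrix :
    Set.range Heis.toMatrix = {A | ∃ a b c : ℂ, A = !![1, a, c; 0, 1, b; 0, 0, 1]} := by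
  ext A
  constructor
  · rintro ⟨g, rfl⟩
    exact ⟨g.a, g.b, g.c, rfl⟩
  · rintro ⟨a, b, c, rfl⟩
    exact ⟨((a, b, c) : ℂ × ℂ × ℂ), rfl⟩

theorem frameForm_eq_div {x : ℂ × ℂ} (hx : x.1 * x.2 ≠ 0) (v w : ℂ × ℂ) :
    frameForm v w =
      ((logAnchor x v).1 * (logAnchor x w).2 - (logAnchor x v).2 * (logAnchor x w).1) /
        (x.1 * x.2) := by
  rw [eq_div_iff hx, logAnchor_apply, logAnchor_apply, frameForm_apply]
  ring

end

theorem mainTheorem12 :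
    -- `H` is the group of unipotent upper triangular `3 × 3` matrices
    (Function.Injective Heis.toMatrix ∧
      (∀ g h : Heis, (g * h).toMatrix = g.toMatrix * h.toMatrix) ∧
      Set.range Heis.toMatrix = {A | ∃ a b c : ℂ, A = !![1, a, c; 0, 1, b; 0, 0, 1]}) ∧
    -- `logTangent` is `T(-log D)`, on which `logForm` is the closed form `dx ∧ dy / (xy)`
    IsLogTangentAlgebroid logTangent ∧
    (logTangent.IsClosedTwoForm logForm ∧
      ∀ x : ℂ × ℂ, x.1 * x.2 ≠ 0 → ∀ v w : logTangent.Fib x,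
        logForm x v w =
          ((logAnchor x v).1 * (logAnchor x w).2 - (logAnchor x v).2 * (logAnchor x w).1) /
            (x.1 * x.2)) ∧
    -- the form defines a central extension of `T(-log D)`
    LieAlgebroidData.IsCentralExtension (logTangent.twist logForm) logTangent
      (fun _ => LinearMap.inr ℂ _ ℂ) (fun _ => LinearMap.fst ℂ _ ℂ) ∧
    -- `0 → ℂ_{ℂ²} → H ⋉ ℂ² → ℂ² ⋉ ℂ² → 0` is a central extension that integrates it
    (GroupoidData.IsCentralExtension 𝓘(ℂ, ℂ × ℂ)
        (𝓘(ℂ, ℂ × ℂ × ℂ).prod 𝓘(ℂ, ℂ × ℂ)) (𝓘(ℂ, ℂ × ℂ).prod 𝓘(ℂ, ℂ × ℂ))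
        (GroupoidData.action Heis.act) (GroupoidData.action AddC2.act) (heisIncl (-1)) heisProj ∧
      GroupoidData.Integrates 𝓘(ℂ, ℂ × ℂ)
        (𝓘(ℂ, ℂ × ℂ × ℂ).prod 𝓘(ℂ, ℂ × ℂ)) (𝓘(ℂ, ℂ × ℂ).prod 𝓘(ℂ, ℂ × ℂ))
        (GroupoidData.action Heis.act) (GroupoidData.action AddC2.act) (heisIncl (-1)) heisProj
        (logTangent.twist logForm) logTangent
        (fun _ => LinearMap.inr ℂ _ ℂ) (fun _ => LinearMap.fst ℂ _ ℂ)) ∧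
    -- with the opposite inclusion of the centre, it integrates the extension defined by `-logForm`
    (GroupoidData.IsCentralExtension 𝓘(ℂ, ℂ × ℂ)
        (𝓘(ℂ, ℂ × ℂ × ℂ).prod 𝓘(ℂ, ℂ × ℂ)) (𝓘(ℂ, ℂ × ℂ).prod 𝓘(ℂ, ℂ × ℂ))
        (GroupoidData.action Heis.act) (GroupoidData.action AddC2.act) (heisIncl 1) heisProj ∧
      GroupoidData.Integrates 𝓘(ℂ, ℂ × ℂ)
        (𝓘(ℂ, ℂ × ℂ × ℂ).prod 𝓘(ℂ, ℂ × ℂ)) (𝓘(ℂ, ℂ × ℂ).prod 𝓘(ℂ, ℂ × ℂ))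
        (GroupoidData.action Heis.act) (GroupoidData.action AddC2.act) (heisIncl 1) heisProj
        (logTangent.twist fun x => -logForm x) logTangent
        (fun _ => LinearMap.inr ℂ _ ℂ) (fun _ => LinearMap.fst ℂ _ ℂ)) := by
  refine ⟨⟨Heis.toMatrix_injective, Heis.toMatrix_mul, Heis.range_toMatrix⟩,
    isLogTangentAlgebroid_logTangent,
    ⟨isClosedTwoForm_logForm, fun x hx v w => frameForm_eq_div hx v w⟩,
    isLieAlgebroid_logTangent.isCentralExtension_twist
      isLogTangentAlgebroid_logTangent.anchor_bracket isClosedTwoForm_logForm,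
    ⟨heis_isCentralExtension (by simp), heis_integrates (by simp) (φ := frameForm) fun u v => ?_⟩,
    heis_isCentralExtension one_ne_zero,
    heis_integrates one_ne_zero (φ := -frameForm) fun u v => ?_⟩
  · exact neg_one_mul _
  · exact one_mul _
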